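/- Let $r\ge 1$, $q=2^r$, let $\mathbb F_q$ be the field with $q$ elements, put $\mathrm{tr}(x)=x+x^2+\cdots+x^{2^{r-1}}\in\mathbb F_2$ for $x\in\mathbb F_q$, and let $n\ge 1$ be odd. Let $O(2n+1,q)$ be the group of isometries of the quadratic form $\theta(x)=\sum_{i=1}^n x_ix_{n+i}+x_{2n+1}^2$ on $\mathbb F_q^{(2n+1)\times 1}$, and let $P$ be its maximal parabolic subgroup $$P=\left\{\begin{bmatrix}A&0&0\\0&{}^tA^{-1}&0\\0&0&1\end{bmatrix}\begin{bmatrix}1_n&B&0\\0&1_n&0\\0&h&1\end{bmatrix}\ :\ A\in GL(n,q),\ B\in\mathbb F_q^{n\times n},\ h\in\mathbb F_q^{1\times n},\ B+{}^thh\text{ alternating}\right\},$$ where a square matrix $M$ is alternating if $M_{ii}=0$ and $M_{ij}=-M_{ji}$ for all $i,j$. Let $\sigma_{n-1}\in O(2n+1,q)$ be the permutation matrix that exchanges the basis vectors $e^i$ and $e^{n+i}$ for $1\le i\le n-1$ and fixes $e^n$, $e^{2n}$, $e^{2n+1}$, and let $DC(n,q)=P\sigma_{n-1}P$. Put $$A(n,q)=q^{\frac14(5n^2-1)}\,\frac{q^n-1}{q-1}\prod_{j=1}^{(n-1)/2}(q^{2j-1}-1),\qquad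 B(n,q)=q^{\frac14(n-1)^2}(q^n-1)\prod_{j=1}^{(n-1)/2}(q^{2j}-1).$$ Let $N(n,q)=|DC(n,q)|$, let $g_1,\dots,g_{N(n,q)}$ be any ordering of the elements of $DC(n,q)$, and let $C(DC(n,q))$ be the binary linear code $$C(DC(n,q))=\Big\{u\in\mathbb F_2^{N(n,q)}\ :\ \sum_{i=1}^{N(n,q)}u_i\,\mathrm{Tr}(g_i)=0\text{ in }\mathbb F_q\Big\},$$ where $\mathrm{Tr}$ is the matrix trace. For $0\le j\le N(n,q)$ let $C_j(n,q)$ be the number of codewords of Hamming weight $j$ in $C(DC(n,q))$. **Theorem.** One has $N(n,q)=A(n,q)B(n,q)$, and, for $j=0,\dots,N(n,q)$, $$C_j(n,q)=\sum\binom{q^{-1}A(n,q)(B(n,q)+1)}{\nu_1}\prod_{\substack{\beta\ne 1\\ \mathrm{tr}((\beta-1)^{-1})=0}}\binom{q^{-1}A(n,q)(B(n,q)+q+1)}{\nu_\beta}\prod_{\substack{\beta\ne 1\\ \mathrm{tr}((\beta-1)^{-1})=1}}\binom{q^{-1}A(n,q)(B(n,q)-q+1)}{\nu_\beta},$$ where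 $\beta$ runs over $\mathbb F_q$, the sum is over all families $\{\nu_\beta\}_{\beta\in\mathbb F_q}$ of nonnegative integers with $\sum_{\beta}\nu_\beta=j$ and $\sum_{\beta}\nu_\beta\beta=0$ in $\mathbb F_q$, and $\binom ba=0$ if $a>b$. -/

import Mathlib

open Matrix

/-- Row and column indices of `(2n+1) × (2n+1)` matrices, split into blocks of sizes `n`, `n`, `1`. -/
abbrev OIdx (n : ℕ) : Type := (Fin n ⊕ Fin n) ⊕ Unit

/-- The quadratic form `θ(x) = ∑ xᵢ xₙ₊ᵢ + x₂ₙ₊₁²` on column vectors of length `2n+1`. -/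
def theta {F : Type*} [Field F] (n : ℕ) (x : OIdx n → F) : F :=
  ∑ i : Fin n, x (.inl (.inl i)) * x (.inl (.inr i)) + x (.inr ()) ^ 2

/-- The orthogonal group `O(2n+1, q)`: the isometries of `θ`. -/
def orthGroup (n : ℕ) (F : Type*) [Field F] : Subgroup (GL (OIdx n) F) where
  carrier := {w | ∀ x : OIdx n → F, theta n (w.1 *ᵥ x) = theta n x}
  mul_mem' := by
    intro a b ha hb x
    rw [Units.val_mul, ← Matrix.mulVec_mulVec, ha, hb]
  one_mem' := by
    intro x
    rw [Units.val_one, Matrix.one_mulVec]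
  inv_mem' := by
    intro a ha x
    have h := ha ((a⁻¹).1 *ᵥ x)
    rw [Matrix.mulVec_mulVec, ← Units.val_mul, mul_inv_cancel, Units.val_one,
      Matrix.one_mulVec] at h
    exact h.symm

/-- Alternating matrices: zero diagonal and `aᵢⱼ = -aⱼᵢ`. -/
def IsAltMatrix {n : ℕ} {F : Type*} [Field F] (M : Matrix (Fin n) (Fin n) F) : Prop :=
  (∀ i, M i i = 0) ∧ ∀ i j, M i j = -M j i

/-- The block diagonal matrix `diag(A, ᵗA⁻¹, 1)`. -/
def leviMatrix {n : ℕ} {F : Type*} [Field F] (A : GL (Fin n) F) :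
    Matrix (OIdx n) (OIdx n) F :=
  fromBlocks (fromBlocks A.1 0 0 (A⁻¹).1ᵀ) 0 0 1

/-- The block matrix `[1 B 0; 0 1 0; 0 h 1]`. -/
def unipotentMatrix {n : ℕ} {F : Type*} [Field F] (B : Matrix (Fin n) (Fin n) F)
    (h : Matrix Unit (Fin n) F) : Matrix (OIdx n) (OIdx n) F :=
  fromBlocks (fromBlocks 1 B 0 1) 0 (fromCols 0 h) 1

/-- The maximal parabolic subgroup `P(2n+1, q)` of `O(2n+1, q)`, as a set of invertible matrices. -/
def parabolic (n : ℕ) (F : Type*) [Field F] : Set (GL (OIdx n) F) :=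
  {w | ∃ (A : GL (Fin n) F) (B : Matrix (Fin n) (Fin n) F) (h : Matrix Unit (Fin n) F),
    IsAltMatrix (B + hᵀ * h) ∧ w.1 = leviMatrix A * unipotentMatrix B h}

/-- The matrix of `σᵣ`: it exchanges the coordinates `i` and `n + i` for the first `r` indices `i`
and fixes the remaining coordinates. -/
def sigmaMatrix (n r : ℕ) (F : Type*) [Field F] : Matrix (OIdx n) (OIdx n) F :=
  fromBlocks
    (fromBlocks
      (diagonal fun i : Fin n => if i.1 < r then 0 else 1)
      (diagonal fun i : Fin n => if i.1 < r then 1 else 0)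
      (diagonal fun i : Fin n => if i.1 < r then 1 else 0)
      (diagonal fun i : Fin n => if i.1 < r then 0 else 1))
    0 0 1

theorem sigmaMatrix_mul_self (n r : ℕ) (F : Type*) [Field F] :
    sigmaMatrix n r F * sigmaMatrix n r F = 1 := by
  simp only [sigmaMatrix, fromBlocks_multiply, diagonal_mul_diagonal, diagonal_add]
  have h1 : (fun i : Fin n => (if i.1 < r then (0 : F) else 1) * (if i.1 < r then 0 else 1) +
      (if i.1 < r then 1 else 0) * (if i.1 < r then 1 else 0)) = 1 := by
    funext i; split_ifs <;> simp
  have h2 : (fun i : Fin n => (if i.1 < r then (0 : F) else 1) * (if i.1 < r then 1 else 0) +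
      (if i.1 < r then 1 else 0) * (if i.1 < r then 0 else 1)) = 0 := by
    funext i; split_ifs <;> simp
  have h3 : (fun i : Fin n => (if i.1 < r then (1 : F) else 0) * (if i.1 < r then 0 else 1) +
      (if i.1 < r then 0 else 1) * (if i.1 < r then 1 else 0)) = 0 := by
    funext i; split_ifs <;> simp
  have h4 : (fun i : Fin n => (if i.1 < r then (1 : F) else 0) * (if i.1 < r then 1 else 0) +
      (if i.1 < r then 0 else 1) * (if i.1 < r then 0 else 1)) = 1 := by
    funext i; split_ifs <;> simp
  rw [h1, h2, h3, h4]
  have h0 : diagonal (0 : Fin n → F) = 0 := diagonal_zero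
  have h5 : diagonal (1 : Fin n → F) = 1 := diagonal_one
  simp [h0, h5, fromBlocks_one]

/-- The element `σᵣ`. -/
def sigmaElt (n r : ℕ) (F : Type*) [Field F] : GL (OIdx n) F :=
  ⟨sigmaMatrix n r F, sigmaMatrix n r F, sigmaMatrix_mul_self n r F, sigmaMatrix_mul_self n r F⟩

/-- `σᵣ` is an isometry of `θ`. -/
theorem sigmaElt_mem_orthGroup (n r : ℕ) (F : Type*) [Field F] :
    sigmaElt n r F ∈ orthGroup n F := by
  intro x
  have hx : x = Sum.elim (Sum.elim (fun i => x (.inl (.inl i))) (fun i => x (.inl (.inr i))))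
      (fun u => x (.inr u)) := by
    funext i; rcases i with (i | i) | i <;> rfl
  rw [hx]
  simp only [sigmaElt, sigmaMatrix, theta, fromBlocks_mulVec, Sum.elim_inl, Sum.elim_inr,
    Sum.elim_comp_inl, Sum.elim_comp_inr, zero_mulVec, add_zero, zero_add, one_mulVec,
    Pi.add_apply, mulVec_diagonal]
  congr 1
  refine Finset.sum_congr rfl fun i _ => ?_
  split_ifs <;> simp [mul_comm]

/-- In characteristic two the set `P(2n+1, q)` consists of isometries of `θ`. -/
theorem parabolic_subset_orthGroup (n : ℕ) (F : Type*) [Field F] [CharP F 2] :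
    parabolic n F ⊆ (orthGroup n F : Set (GL (OIdx n) F)) := by
  rintro w ⟨A, B, h, hB, hw⟩ x
  have hθ : ∀ (a b : Fin n → F) (c : Unit → F),
      theta n (Sum.elim (Sum.elim a b) c) = a ⬝ᵥ b + c () ^ 2 := fun a b c => rfl
  have hx : x = Sum.elim (Sum.elim (fun i => x (.inl (.inl i))) (fun i => x (.inl (.inr i))))
      (fun u => x (.inr u)) := by
    funext i; rcases i with (i | i) | i <;> rfl
  generalize (fun i => x (.inl (.inl i))) = a at hx
  generalize (fun i => x (.inl (.inr i))) = b at hx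
  generalize (fun i => x (.inr i)) = c at hx
  subst hx
  have key : b ⬝ᵥ (B *ᵥ b) + (h *ᵥ b) () ^ 2 = 0 := by
    have e : b ⬝ᵥ ((B + hᵀ * h) *ᵥ b) = b ⬝ᵥ (B *ᵥ b) + (h *ᵥ b) () ^ 2 := by
      rw [add_mulVec, dotProduct_add, ← mulVec_mulVec, dotProduct_mulVec b hᵀ,
        vecMul_transpose]
      simp [dotProduct, sq]
    rw [← e]
    have hM := hB
    generalize B + hᵀ * h = M at hM
    simp only [dotProduct, mulVec, Finset.mul_sum]
    rw [← Finset.sum_product']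
    refine Finset.sum_involution (fun p _ => (p.2, p.1)) ?_ ?_ ?_ ?_
    · rintro ⟨i, j⟩ _
      simp only
      rw [hM.2 i j]
      ring
    · rintro ⟨i, j⟩ _ hne heq
      simp only [Prod.mk.injEq] at heq
      obtain ⟨rfl, -⟩ := heq
      simp [hM.1] at hne
    · intros; simp
    · intros; simp
  have hlevi : ∀ y : Fin n → F, (A.1 *ᵥ y) ⬝ᵥ ((A⁻¹).1ᵀ *ᵥ b) = y ⬝ᵥ b := by
    intro y
    rw [dotProduct_mulVec, vecMul_transpose, mulVec_mulVec, ← Units.val_mul, inv_mul_cancel,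
      Units.val_one, one_mulVec]
  rw [hw, ← mulVec_mulVec]
  simp only [leviMatrix, unipotentMatrix, fromBlocks_mulVec, Sum.elim_comp_inl,
    Sum.elim_comp_inr, zero_mulVec, add_zero, zero_add, one_mulVec, fromCols_mulVec, hθ, hlevi,
    Pi.add_apply, add_dotProduct]
  rw [dotProduct_comm (B *ᵥ b) b]
  have h2 : (2 : F) = 0 := CharTwo.two_eq_zero
  linear_combination key + (h *ᵥ b) () * c () * h2

/-- The double coset `DC(n, q) = P σₙ₋₁ P`. -/
def DC (n : ℕ) (F : Type*) [Field F] : Set (GL (OIdx n) F) :=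
  DoubleCoset.doubleCoset (sigmaElt n (n - 1) F) (parabolic n F) (parabolic n F)

/-- The binary code `C(DC(n, q))` for an ordering `g` of the elements of `DC(n, q)`: the binary
words `u` with `∑ uᵢ Tr(gᵢ) = 0` in `F_q`. -/
def codeDC {n : ℕ} {F : Type*} [Field F] [Algebra (ZMod 2) F] {N : ℕ} (g : Fin N ≃ DC n F) :
    Submodule (ZMod 2) (Fin N → ZMod 2) where
  carrier := {u | ∑ i, u i • (g i).1.1.trace = 0}
  add_mem' := by
    intro a b ha hb
    simp only [Set.mem_ofPred_eq] at ha hb ⊢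
    simp only [Pi.add_apply, add_smul, Finset.sum_add_distrib, ha, hb, add_zero]
  zero_mem' := by simp
  smul_mem' := by
    intro c a ha
    simp only [Set.mem_ofPred_eq] at ha ⊢
    simp only [Pi.smul_apply, smul_assoc, ← Finset.smul_sum, ha, smul_zero]

/-- Weight distribution of a binary code: the number of codewords of Hamming weight `j`. -/
noncomputable def weightCount {N : ℕ} (C : Submodule (ZMod 2) (Fin N → ZMod 2)) (j : ℕ) : ℕ :=
  {u : Fin N → ZMod 2 | u ∈ C ∧ hammingNorm u = j}.ncard

/-- The absolute trace `x + x² + ⋯ + x^(2^(r-1))` of the field with `2^r` elements; its values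
`0`, `1` are regarded as elements of the field. -/
def absTr {F : Type*} [Field F] (r : ℕ) (x : F) : F := ∑ i ∈ Finset.range r, x ^ 2 ^ i

/-- `A(n, q) = q^((5n²-1)/4) [n choose 1]_q ∏_{j=1}^{(n-1)/2} (q^(2j-1) - 1)`, where
`[n choose 1]_q = (q^n - 1)/(q - 1)`. For odd `n` and `q ≥ 2` all divisions are exact. -/
def Aconst (n q : ℕ) : ℕ :=
  q ^ ((5 * n ^ 2 - 1) / 4) * ((q ^ n - 1) / (q - 1)) *
    ∏ j ∈ Finset.Icc 1 ((n - 1) / 2), (q ^ (2 * j - 1) - 1)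

/-- `B(n, q) = q^((n-1)²/4) (q^n - 1) ∏_{j=1}^{(n-1)/2} (q^(2j) - 1)`. -/
def Bconst (n q : ℕ) : ℕ :=
  q ^ ((n - 1) ^ 2 / 4) * (q ^ n - 1) * ∏ j ∈ Finset.Icc 1 ((n - 1) / 2), (q ^ (2 * j) - 1)

/-- For odd `n` the quantity `q⁻¹ A(n, q)` is an integer. -/
theorem dvd_Aconst {n q : ℕ} (hn : Odd n) : q ∣ Aconst n q := by
  obtain ⟨k, rfl⟩ := hn
  have h : (5 * (2 * k + 1) ^ 2 - 1) / 4 ≠ 0 := by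
    have : 4 ≤ 5 * (2 * k + 1) ^ 2 - 1 := by
      have : 1 ≤ (2 * k + 1) ^ 2 := Nat.one_le_pow _ _ (by omega)
      omega
    omega
  exact Dvd.dvd.mul_right (Dvd.dvd.mul_right (dvd_pow_self q h) _) _

/-- The quantity `B(n, q) - q + 1` is nonnegative. -/
theorem le_Bconst_add_one {n q : ℕ} (hn : Odd n) (hq : 2 ≤ q) : q ≤ Bconst n q + 1 := by
  have h1 : q ≤ q ^ n := Nat.le_self_pow (by rintro rfl; simp at hn) q
  have h2 : 0 < q ^ ((n - 1) ^ 2 / 4) := by positivity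
  have h3 : 0 < ∏ j ∈ Finset.Icc 1 ((n - 1) / 2), (q ^ (2 * j) - 1) := by
    refine Finset.prod_pos fun j hj => ?_
    have : 1 < q ^ (2 * j) := Nat.one_lt_pow (by have := Finset.mem_Icc.1 hj; omega) hq
    omega
  have h4 : q ^ n - 1 ≤ Bconst n q :=
    (Nat.le_mul_of_pos_left _ h2).trans (Nat.le_mul_of_pos_right _ h3)
  omega

/-! A word in the code is a set of positions on which the traces sum to zero. Sorting these sets by
how many positions they take from each trace fibre gives the sum of products of binomials
(`weightCount_codeDC`), so everything reduces to the fibre sizes N_β = #{w ∈ DC : Tr w = β}.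

Trace is a class function, so Tr(p σ p') = Tr(σ p' p). Hence N_β is the index of P ∩ σPσ⁻¹ in P
times the number of p ∈ P with Tr(σp) = β. In characteristic two P is parametrised by A ∈ GL_n and a
symmetric B, since h is the vector of square roots of the diagonal of B. With D = diag(1,…,1,0) and
the last diagonal entries of A and A⁻¹, one finds Tr(σp) = 1 + A_nn + (A⁻¹)_nn + tr(DAB).

For fixed A the map B ↦ tr(DAB) is a linear functional on symmetric matrices, zero exactly when DA
is alternating (`traceFunctional_eq_zero_iff`). A nonzero functional spreads B evenly over F_q. The
zero functional occurs when A is lower block triangular with an invertible alternating block of size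
n-1 and a corner d. Then every B contributes if 1 + d + d⁻¹ = β, and none does otherwise.

If u(β) counts these d, summing over A gives q N_β = A(n,q) (B(n,q) + q u(β) - q + 1)
(`card_DC_trace`), where the constants come from the orders of GL_n and of the set of invertible
alternating matrices. Finally u(1) = 1, and for β ≠ 1 an Artin–Schreier equation makes u(β) equal to
2 or 0 according to the trace of (β-1)⁻¹. -/

/-! ### Counting principles: double cosets, linear functionals, words by fibre sizes -/

/-- Counting a class function on a double coset `K s K` through pairs of elements of `K`. -/
theorem card_doubleCoset_mul_card_stabilizer {G : Type*} [Group G] (K : Subgroup G) (s : G)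
    (T : G → Prop) (hT : ∀ x y, T (x * y) ↔ T (y * x)) :
    Nat.card {w : G // w ∈ DoubleCoset.doubleCoset s (K : Set G) K ∧ T w} *
      Nat.card {p : K // s⁻¹ * p.1 * s ∈ K} =
    Nat.card K * Nat.card {p : K // T (s * p.1)} := by
  rw [← Nat.card_prod, ← Nat.card_prod]
  have hsec : ∀ w : {w : G // w ∈ DoubleCoset.doubleCoset s (K : Set G) K ∧ T w},
      ∃ x : K × K, w.1 = x.1.1 * s * x.2.1 := by
    rintro ⟨w, hw, -⟩
    obtain ⟨a, ha, b, hb, rfl⟩ := DoubleCoset.mem_doubleCoset.1 hw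
    exact ⟨(⟨a, ha⟩, ⟨b, hb⟩), rfl⟩
  choose c hc using hsec
  have hconj : ∀ p p' : G, T (p * s * p') ↔ T (s * (p' * p)) := fun p p' => by
    rw [mul_assoc, hT, mul_assoc]
  -- From the chosen w = c₁ s c₂ all factorisations are (c₁h) s ((s⁻¹hs)⁻¹c₂) with h ∈ K ∩ sKs⁻¹. A
  -- factorisation p s p' is recorded as (p, p'p), because T(p s p') depends only on p'p.
  let f : {w : G // w ∈ DoubleCoset.doubleCoset s (K : Set G) K ∧ T w} ×
      {p : K // s⁻¹ * p.1 * s ∈ K} → K × {p : K // T (s * p.1)} := fun x =>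
    ((c x.1).1 * x.2.1, ⟨⟨(s⁻¹ * x.2.1.1 * s)⁻¹, K.inv_mem x.2.2⟩ * (c x.1).2 *
      ((c x.1).1 * x.2.1), by
        have h := x.1.2.2
        rw [hc x.1] at h
        have e : (c x.1).1.1 * s * (c x.1).2.1 =
          ((c x.1).1.1 * x.2.1.1) * s * ((s⁻¹ * x.2.1.1 * s)⁻¹ * (c x.1).2.1) := by group
        rw [e, hconj] at h
        simpa using h⟩)
  refine Nat.card_eq_of_bijective f ⟨?_, ?_⟩
  · rintro ⟨w, h⟩ ⟨w', h'⟩ hf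
    simp only [f, Prod.mk.injEq, Subtype.mk.injEq] at hf
    obtain ⟨h1, h2⟩ := hf
    rw [h1] at h2
    have h2 := mul_right_cancel h2
    have h1' := congrArg Subtype.val h1
    have h2' := congrArg Subtype.val h2
    simp only [Subgroup.coe_mul] at h1' h2'
    have hw : w = w' := by
      apply Subtype.ext
      rw [hc w, hc w']
      calc (c w).1.1 * s * (c w).2.1
          = ((c w).1.1 * h.1.1) * s * ((s⁻¹ * h.1.1 * s)⁻¹ * (c w).2.1) := by group
        _ = (c w').1.1 * s * (c w').2.1 := by rw [h1', h2']; group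
    subst hw
    have := mul_left_cancel h1
    rw [Prod.mk.injEq]
    exact ⟨rfl, Subtype.ext this⟩
  · rintro ⟨p, p', hp'⟩
    have hTw : T (p.1 * s * (p'.1 * p.1⁻¹)) := by
      rw [hconj]; simpa using hp'
    have hmem : p.1 * s * (p'.1 * p.1⁻¹) ∈ DoubleCoset.doubleCoset s (K : Set G) K :=
      DoubleCoset.mem_doubleCoset.2 ⟨p.1, p.2, _, K.mul_mem p'.2 (K.inv_mem p.2), rfl⟩
    have hw := hc ⟨_, hmem, hTw⟩
    generalize hgw : (⟨p.1 * s * (p'.1 * p.1⁻¹), hmem, hTw⟩ : {w : G // w ∈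
      DoubleCoset.doubleCoset s (K : Set G) K ∧ T w}) = w at hw
    have hwv : w.1 = p.1 * s * (p'.1 * p.1⁻¹) := by rw [← hgw]
    rw [hwv] at hw
    -- Comparing two factorisations of the same w: the conjugate of h = c₁⁻¹p is a product of
    -- elements of K, so h is admissible.
    have key : s⁻¹ * ((c w).1.1⁻¹ * p.1) * s = (c w).2.1 * (p'.1 * p.1⁻¹)⁻¹ := by
      have : p.1 = (c w).1.1 * s * (c w).2.1 * (p'.1 * p.1⁻¹)⁻¹ * s⁻¹ := by
        rw [← hw]; group
      nth_rewrite 1 [this]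
      group
    refine ⟨(w, ⟨(c w).1⁻¹ * p, ?_⟩), ?_⟩
    · have : s⁻¹ * ((c w).1⁻¹ * p).1 * s = _ := key
      rw [this]
      exact K.mul_mem (c w).2.2 (K.inv_mem (K.mul_mem p'.2 (K.inv_mem p.2)))
    · simp only [f, Prod.mk.injEq, mul_inv_cancel_left, true_and]
      apply Subtype.ext
      apply Subtype.ext
      simp only [Subgroup.coe_mul, Subgroup.coe_inv, key]
      group

/-- The fibres of a nonzero linear functional are equally large. -/
theorem card_fiber_mul_card {F V : Type*} [Field F] [AddCommGroup V] [Module F V] [Finite V]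
    (φ : V →ₗ[F] F) (hφ : φ ≠ 0) (c : F) :
    Nat.card {v // φ v = c} * Nat.card F = Nat.card V := by
  have hs : Function.Surjective φ := LinearMap.surjective hφ
  have e : ∀ d : F, Nonempty ({v // φ v = c} ≃ {v // φ v = d}) := by
    intro d
    obtain ⟨u, hu⟩ := hs (d - c)
    exact ⟨(Equiv.addRight u).subtypeEquiv fun v => by
      rw [Equiv.coe_addRight, map_add, hu]
      constructor
      · intro h; rw [h]; ring
      · intro h; linear_combination h⟩
  rw [← Nat.card_prod]
  refine Nat.card_congr (Equiv.trans ?_ (Equiv.sigmaFiberEquiv φ))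
  exact ((Equiv.prodComm _ _).trans (Equiv.sigmaEquivProd _ _).symm).trans
    (Equiv.sigmaCongrRight fun d => (e d).some)

/-- The number of subsets with prescribed intersections with the fibres of `t`. -/
theorem card_finset_prescribed_fibers {ι α : Type*} [Fintype ι] [DecidableEq ι] [Fintype α]
    [DecidableEq α] (t : ι → α) (ν : α → ℕ) :
    (Finset.univ.filter fun S : Finset ι => ∀ a, (S.filter fun i => t i = a).card = ν a).card =
      ∏ a, ((Finset.univ.filter fun i => t i = a).card).choose (ν a) := by
  have h : ∏ a, ((Finset.univ.filter fun i => t i = a).card).choose (ν a) =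
      (Fintype.piFinset fun a =>
        (Finset.univ.filter fun i => t i = a).powersetCard (ν a)).card := by
    rw [Fintype.card_piFinset]
    simp only [Finset.card_powersetCard]
  rw [h]
  refine Finset.card_bij' (fun S _ a => S.filter fun i => t i = a)
    (fun f _ => Finset.univ.filter fun i => i ∈ f (t i)) ?_ ?_ ?_ ?_
  · intro S hS
    simp only [Finset.mem_filter, Finset.mem_univ, true_and] at hS
    simp only [Fintype.mem_piFinset, Finset.mem_powersetCard]
    exact fun a => ⟨Finset.filter_subset_filter _ (Finset.subset_univ _), hS a⟩
  · intro f hf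
    simp only [Fintype.mem_piFinset, Finset.mem_powersetCard] at hf
    simp only [Finset.mem_filter, Finset.mem_univ, true_and]
    intro a
    rw [← (hf a).2]
    congr 1
    ext i
    simp only [Finset.mem_filter, Finset.mem_univ, true_and]
    constructor
    · rintro ⟨h1, rfl⟩; exact h1
    · intro hi
      have := (hf a).1 hi
      simp only [Finset.mem_filter, Finset.mem_univ, true_and] at this
      subst this; exact ⟨hi, rfl⟩
  · intro S hS
    ext i; simp
  · intro f hf
    simp only [Fintype.mem_piFinset, Finset.mem_powersetCard] at hf
    funext a
    ext i
    simp only [Finset.mem_filter, Finset.mem_univ, true_and]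
    constructor
    · rintro ⟨h1, rfl⟩; exact h1
    · intro hi
      have := (hf a).1 hi
      simp only [Finset.mem_filter, Finset.mem_univ, true_and] at this
      subst this; exact ⟨hi, rfl⟩

/-- The weight distribution of the binary code of zero-sum words, by fibre sizes. -/
theorem weightCount_codeDC {n : ℕ} {F : Type*} [Field F] [Fintype F] [DecidableEq F]
    [Algebra (ZMod 2) F] {N : ℕ} (g : Fin N ≃ DC n F) (j : ℕ) :
    weightCount (codeDC g) j =
      ∑ ν ∈ (Finset.piAntidiag (Finset.univ : Finset F) j).filter (fun ν => ∑ β : F, ν β • β = 0),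
        ∏ β : F, (Nat.card {w : DC n F // w.1.1.trace = β}).choose (ν β) := by
  set t : Fin N → F := fun i => (g i).1.1.trace with ht
  have hfib : ∀ β, Nat.card {w : DC n F // w.1.1.trace = β} =
      (Finset.univ.filter fun i => t i = β).card := by
    intro β
    rw [← Fintype.card_subtype, ← Nat.card_eq_fintype_card]
    exact (Nat.card_congr (g.subtypeEquiv fun i => by simp [ht])).symm
  simp only [hfib]
  -- Binary words are identified with their supports.
  have hw : weightCount (codeDC g) j =
      (Finset.univ.filter fun S : Finset (Fin N) => ∑ i ∈ S, t i = 0 ∧ S.card = j).card := by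
    classical
    have hz : ∀ a : ZMod 2, a = 0 ∨ a = 1 := by decide
    rw [weightCount, Set.ncard_eq_toFinset_card']
    refine Finset.card_bij' (fun u _ => Finset.univ.filter fun i => u i ≠ 0)
      (fun S _ i => if i ∈ S then 1 else 0) ?_ ?_ ?_ ?_
    · intro u hu
      simp only [Set.mem_toFinset, Set.mem_ofPred_eq] at hu
      simp only [Finset.mem_filter, Finset.mem_univ, true_and]
      refine ⟨?_, hu.2⟩
      rw [Finset.sum_filter]
      refine Eq.trans ?_ (show ∑ i, u i • t i = 0 from hu.1)
      refine Finset.sum_congr rfl fun i _ => ?_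
      rcases hz (u i) with h | h <;> simp [h]
    · intro S hS
      simp only [Finset.mem_filter, Finset.mem_univ, true_and] at hS
      simp only [Set.mem_toFinset, Set.mem_ofPred_eq]
      refine ⟨?_, ?_⟩
      · show ∑ i, (if i ∈ S then (1 : ZMod 2) else 0) • t i = 0
        simpa [ite_smul] using hS.1
      · simp [hammingNorm, hS.2]
    · intro u hu
      funext i
      simp only [Finset.mem_filter, Finset.mem_univ, true_and]
      rcases hz (u i) with h | h <;> simp [h]
    · intro S hS
      ext i; simp
  rw [hw]
  simp only [← card_finset_prescribed_fibers t]
  -- A set S determines its profile ν, so the sum over ν is a disjoint union.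
  rw [← Finset.card_biUnion]
  · congr 1
    ext S
    simp only [Finset.mem_filter, Finset.mem_univ, true_and, Finset.mem_biUnion,
      Finset.mem_piAntidiag]
    have hsum : ∑ β, (S.filter fun i => t i = β).card • β = ∑ i ∈ S, t i := by
      rw [← Finset.sum_fiberwise S t t]
      refine Finset.sum_congr rfl fun β _ => ?_
      rw [← Finset.sum_const]
      exact Finset.sum_congr rfl fun i hi => (Finset.mem_filter.1 hi).2.symm
    have hcard : ∑ β, (S.filter fun i => t i = β).card = S.card :=
      (Finset.card_eq_sum_card_fiberwise (fun i _ => Finset.mem_univ (t i))).symm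
    constructor
    · rintro ⟨h1, h2⟩
      exact ⟨fun β => (S.filter fun i => t i = β).card,
        ⟨⟨hcard.trans h2, by simp⟩, hsum.trans h1⟩, fun _ => rfl⟩
    · rintro ⟨ν, ⟨⟨h1, -⟩, h2⟩, h3⟩
      rw [← hsum, ← hcard]
      simp only [h3]
      exact ⟨h2, h1⟩
  · intro ν _ ν' _ hne
    rw [Function.onFun, Finset.disjoint_left]
    intro S h1 h2
    simp only [Finset.mem_filter, Finset.mem_univ, true_and] at h1 h2
    exact hne (funext fun a => (h1 a).symm.trans (h2 a))

/-! ### The absolute trace and the equation 1 + d + d⁻¹ = β -/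

open Polynomial in
theorem card_absTr_eq_zero_le {F : Type*} [Field F] [Fintype F] [DecidableEq F] {r : ℕ} (hr : 1 ≤ r) :
    (Finset.univ.filter fun x : F => absTr r x = 0).card ≤ 2 ^ (r - 1) := by
  set p : F[X] := ∑ i ∈ Finset.range r, X ^ 2 ^ i with hp
  have heval : ∀ x, p.eval x = absTr r x := by
    intro x; simp [hp, absTr, eval_finsetSum]
  -- Only the term i = 0 is linear. This makes p nonzero, so its degree bounds the number of roots.
  have hcoeff : p.coeff 1 = 1 := by
    obtain ⟨s, rfl⟩ : ∃ s, r = s + 1 := ⟨r - 1, by omega⟩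
    rw [hp, finsetSum_coeff, Finset.sum_range_succ']
    have : ∀ i ∈ Finset.range s, (X ^ 2 ^ (i + 1) : F[X]).coeff 1 = 0 := by
      intro i _
      rw [coeff_X_pow, if_neg]
      exact (Nat.one_lt_two_pow (by omega)).ne
    rw [Finset.sum_eq_zero this]; simp
  have hp0 : p ≠ 0 := by
    intro h; rw [h] at hcoeff; simp at hcoeff
  have hdeg : p.natDegree ≤ 2 ^ (r - 1) := by
    refine natDegree_sum_le_of_forall_le _ _ fun i hi => ?_
    rw [natDegree_X_pow]
    have := Finset.mem_range.1 hi
    exact Nat.pow_le_pow_right (by norm_num) (by omega)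
  calc _ ≤ p.roots.toFinset.card := Finset.card_le_card fun x hx => by
        simp only [Finset.mem_filter, Finset.mem_univ, true_and] at hx
        simp [hp0, heval, hx]
    _ ≤ p.natDegree := p.roots.toFinset_card_le.trans p.card_roots'
    _ ≤ _ := hdeg

section ArtinSchreier

variable {F : Type*} [Field F] [CharP F 2]

/-- The number of units `d` with `1 + d + d⁻¹ = β`. -/
noncomputable def unitTraceCount (F : Type*) [Field F] (β : F) : ℕ :=
  Nat.card {d : Fˣ // (1 : F) + d + (d⁻¹ : Fˣ) = β}

theorem unitTrace_iff (d : Fˣ) (β : F) :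
    (1 : F) + d + (d⁻¹ : Fˣ) = β ↔ (d : F) ^ 2 + (β - 1) * d + 1 = 0 := by
  have hd : (d : F) * (d⁻¹ : Fˣ) = 1 := by simp
  have h2 : (2 : F) = 0 := CharTwo.two_eq_zero
  constructor
  · intro h
    rw [← h]
    linear_combination hd + ((d : F) ^ 2 + 1) * h2
  · intro h
    have h3 : (d : F) * ((1 : F) + d + (d⁻¹ : Fˣ) - β) = 0 := by
      linear_combination h + hd + (d - β * d) * h2
    have := (mul_eq_zero.1 h3).resolve_left d.ne_zero
    exact sub_eq_zero.1 this

/-- At β = 1 the quadratic degenerates to (d - 1)² = 0. -/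
theorem unitTraceCount_one : unitTraceCount F 1 = 1 := by
  rw [unitTraceCount, Nat.card_eq_one_iff_unique]
  have key : ∀ d : Fˣ, (1 : F) + d + (d⁻¹ : Fˣ) = 1 ↔ d = 1 := by
    intro d
    rw [unitTrace_iff]
    have h2 : (2 : F) = 0 := CharTwo.two_eq_zero
    constructor
    · intro h
      have : ((d : F) - 1) ^ 2 = 0 := by linear_combination h - d * h2
      exact Units.ext (sub_eq_zero.1 (pow_eq_zero_iff (two_ne_zero)|>.1 this))
    · rintro rfl; push_cast; linear_combination h2
  exact ⟨⟨fun a b => Subtype.ext (((key _).1 a.2).trans ((key _).1 b.2).symm)⟩,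
    ⟨⟨1, (key 1).2 rfl⟩⟩⟩

/-- Dividing d² + cd + 1 = 0 by c², c = β - 1, gives y² + y = c⁻² for y = d/c. Solvability then
depends on the trace of c⁻², the square of that of c⁻¹. -/
theorem unitTrace_iff_artinSchreier {β : F} (hβ : β ≠ 1) (d : Fˣ) :
    (1 : F) + d + (d⁻¹ : Fˣ) = β ↔
      ((β - 1)⁻¹ * d) ^ 2 + (β - 1)⁻¹ * d = ((β - 1)⁻¹) ^ 2 := by
  rw [unitTrace_iff]
  have hc : β - 1 ≠ 0 := sub_ne_zero.2 hβ
  have h2 : (2 : F) = 0 := CharTwo.two_eq_zero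
  generalize β - 1 = c at hc
  field_simp
  constructor
  · intro h; linear_combination h - h2
  · intro h; linear_combination h + h2

theorem absTr_add (r : ℕ) (x y : F) : absTr r (x + y) = absTr r x + absTr r y := by
  simp only [absTr, add_pow_char_pow, Finset.sum_add_distrib]

theorem absTr_sq (r : ℕ) (x : F) : absTr r (x ^ 2) = absTr r x ^ 2 := by
  simp only [absTr, sum_pow_char, ← pow_mul, mul_comm]

variable [Fintype F]

/-- Squaring shifts the sum by one term, and x^(2^r) = x closes the cycle. -/
theorem absTr_sq_add_self {r : ℕ} (hF : Fintype.card F = 2 ^ r) (x : F) :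
    absTr r (x ^ 2) + absTr r x = 0 := by
  have h : absTr r (x ^ 2) + x = absTr r x + x ^ 2 ^ r := by
    have h1 := Finset.sum_range_succ (fun i => x ^ 2 ^ i) r
    have h2 := Finset.sum_range_succ' (fun i => x ^ 2 ^ i) r
    simp only [pow_zero, pow_one] at h2
    simp only [absTr, ← pow_mul, ← pow_succ']
    rw [← h2, h1]
  rw [← hF, FiniteField.pow_card] at h
  rw [add_right_cancel h, CharTwo.add_self_eq_zero]

theorem absTr_eq_zero_or_one {r : ℕ} (hF : Fintype.card F = 2 ^ r) (x : F) :
    absTr r x = 0 ∨ absTr r x = 1 := by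
  have h := absTr_sq_add_self hF x
  rw [absTr_sq] at h
  have h' : absTr r x * (absTr r x - 1) = 0 := by
    rw [CharTwo.sub_eq_add]; linear_combination h
  rcases mul_eq_zero.1 h' with h0 | h1
  · exact Or.inl h0
  · exact Or.inr (sub_eq_zero.1 h1)

/-- Additive Hilbert 90 for the field with `2^r` elements. -/
theorem absTr_eq_zero_iff {r : ℕ} (hF : Fintype.card F = 2 ^ r) (z : F) :
    absTr r z = 0 ↔ ∃ y, y ^ 2 + y = z := by
  classical
  have hr : 1 ≤ r := by
    rcases Nat.eq_zero_or_pos r with rfl | h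
    · have := Fintype.one_lt_card (α := F); simp [hF] at this
    · exact h
  constructor
  · have hsub : (Finset.univ.image fun y : F => y ^ 2 + y) ⊆
        Finset.univ.filter fun x : F => absTr r x = 0 := by
      intro x hx
      obtain ⟨y, -, rfl⟩ := Finset.mem_image.1 hx
      simp [absTr_add, absTr_sq_add_self hF]
    -- The map y ↦ y² + y is at most two-to-one, with fibres inside {y, y + 1}. Its image has at
    -- least 2^(r-1) elements, as many as the root bound allows to the trace-zero set, so the two
    -- sets coincide.
    have hcard : Fintype.card F ≤ 2 * (Finset.univ.image fun y : F => y ^ 2 + y).card := by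
      rw [← Finset.card_univ]
      refine Finset.card_le_mul_card_image _ 2 fun b hb => ?_
      obtain ⟨y, -, rfl⟩ := Finset.mem_image.1 hb
      refine le_trans (Finset.card_le_card (t := ({y, y + 1} : Finset F)) ?_)
        (Finset.card_le_two (a := y) (b := y + 1))
      intro x hx
      simp only [Finset.mem_filter, Finset.mem_univ, true_and] at hx
      have : (x - y) * (x - (y + 1)) = 0 := by
        have h2 : (2 : F) = 0 := CharTwo.two_eq_zero
        linear_combination hx + (y ^ 2 + y - x * y - x) * h2
      simp only [Finset.mem_insert, Finset.mem_singleton]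
      rcases mul_eq_zero.1 this with h | h
      · exact Or.inl (sub_eq_zero.1 h)
      · exact Or.inr (sub_eq_zero.1 h)
    have heq := Finset.eq_of_subset_of_card_le hsub (by
      have h1 := card_absTr_eq_zero_le (F := F) hr
      have h2 : 2 ^ r = 2 * 2 ^ (r - 1) := by rw [← pow_succ']; congr 1; omega
      omega)
    intro hz
    have : z ∈ Finset.univ.filter fun x : F => absTr r x = 0 := by simp [hz]
    rw [← heq] at this
    obtain ⟨y, -, hy⟩ := Finset.mem_image.1 this
    exact ⟨y, hy⟩
  · rintro ⟨y, rfl⟩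
    rw [absTr_add, absTr_sq_add_self hF]

theorem unitTraceCount_of_absTr_eq_one {r : ℕ} (hF : Fintype.card F = 2 ^ r) {β : F}
    (hβ : β ≠ 1) (h : absTr r ((β - 1)⁻¹) = 1) : unitTraceCount F β = 0 := by
  rw [unitTraceCount, Nat.card_eq_zero]
  refine Or.inl ⟨?_⟩
  rintro ⟨d, hd⟩
  rw [unitTrace_iff_artinSchreier hβ] at hd
  have := (absTr_eq_zero_iff hF _).2 ⟨_, hd⟩
  rw [absTr_sq, h] at this
  simp at this

/-- The two solutions are (β - 1)y and (β - 1)(y + 1). Both are units because y(y + 1) = (β - 1)⁻²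
is nonzero. -/
theorem unitTraceCount_of_absTr_eq_zero {r : ℕ} (hF : Fintype.card F = 2 ^ r) {β : F}
    (hβ : β ≠ 1) (h : absTr r ((β - 1)⁻¹) = 0) : unitTraceCount F β = 2 := by
  have h2 : (2 : F) = 0 := CharTwo.two_eq_zero
  obtain ⟨y, hy⟩ := (absTr_eq_zero_iff hF (((β - 1)⁻¹) ^ 2)).1 (by rw [absTr_sq, h]; simp)
  have hc : β - 1 ≠ 0 := sub_ne_zero.2 hβ
  have hy' : y * (y + 1) ≠ 0 := by
    have : y * (y + 1) = ((β - 1)⁻¹) ^ 2 := by rw [← hy]; ring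
    rw [this]; exact pow_ne_zero _ (inv_ne_zero hc)
  have hy0 : y ≠ 0 := left_ne_zero_of_mul hy'
  have hy1 : y + 1 ≠ 0 := right_ne_zero_of_mul hy'
  rw [unitTraceCount, Nat.card_eq_two_iff]
  refine ⟨⟨Units.mk0 ((β - 1) * y) (mul_ne_zero hc hy0), ?_⟩,
    ⟨Units.mk0 ((β - 1) * (y + 1)) (mul_ne_zero hc hy1), ?_⟩, ?_, ?_⟩
  · rw [unitTrace_iff_artinSchreier hβ, Units.val_mk0, inv_mul_cancel_left₀ hc, hy]
  · rw [unitTrace_iff_artinSchreier hβ, Units.val_mk0, inv_mul_cancel_left₀ hc]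
    linear_combination hy + (y + 1) * h2
  · intro he
    have := congrArg (fun u => (u.1 : F)) he
    simp only [Units.val_mk0] at this
    have := mul_left_cancel₀ hc this
    simp at this
  · rw [Set.eq_univ_iff_forall]
    rintro ⟨d, hd⟩
    rw [unitTrace_iff_artinSchreier hβ] at hd
    have : ((β - 1)⁻¹ * d - y) * ((β - 1)⁻¹ * d - (y + 1)) = 0 := by
      generalize (β - 1)⁻¹ * (d : F) = x at hd
      linear_combination hd - hy + (y ^ 2 + y - x * y - x) * h2
    simp only [Set.mem_insert_iff, Set.mem_singleton_iff, Subtype.mk.injEq]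
    rcases mul_eq_zero.1 this with h | h
    · left; apply Units.ext
      rw [Units.val_mk0, ← sub_eq_zero.1 h, mul_inv_cancel_left₀ hc]
    · right; apply Units.ext
      rw [Units.val_mk0, ← sub_eq_zero.1 h, mul_inv_cancel_left₀ hc]

end ArtinSchreier

/-! ### Invertible alternating matrices and their number -/

section Alternating

variable {F : Type*} [Field F] {κ : Type*}

/-- Alternating square matrices over an arbitrary index type. -/
def IsAlternating (M : Matrix κ κ F) : Prop := (∀ i, M i i = 0) ∧ ∀ i j, M i j = -M j i

theorem isAlternating_fromBlocks_iff {ι : Type*} {a : Matrix ι ι F} {b : Matrix ι κ F}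
    {c : Matrix κ ι F} {d : Matrix κ κ F} :
    IsAlternating (fromBlocks a b c d) ↔ IsAlternating a ∧ b = -cᵀ ∧ IsAlternating d := by
  constructor
  · rintro ⟨h1, h2⟩
    exact ⟨⟨fun i => h1 (.inl i), fun i j => h2 (.inl i) (.inl j)⟩,
      Matrix.ext fun i j => h2 (.inl i) (.inr j),
      ⟨fun i => h1 (.inr i), fun i j => h2 (.inr i) (.inr j)⟩⟩
  · rintro ⟨⟨h1, h2⟩, rfl, ⟨h3, h4⟩⟩
    refine ⟨?_, ?_⟩
    · rintro (i | i)
      · exact h1 i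
      · exact h3 i
    · rintro (i | i) (j | j)
      · exact h2 i j
      · simp
      · simp
      · exact h4 i j

theorem isAlternating_unit_iff {a : Matrix Unit Unit F} : IsAlternating a ↔ a = 0 := by
  constructor
  · rintro ⟨h, -⟩
    ext i j
    exact h i
  · rintro rfl
    exact ⟨fun _ => rfl, fun _ _ => by simp⟩

theorem isAlternating_submatrix_equiv {ι : Type*} (e : ι ≃ κ) {M : Matrix κ κ F} :
    IsAlternating (M.submatrix e e) ↔ IsAlternating M := by
  constructor
  · rintro ⟨h1, h2⟩
    refine ⟨fun i => by simpa using h1 (e.symm i), fun i j => by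
      simpa using h2 (e.symm i) (e.symm j)⟩
  · rintro ⟨h1, h2⟩
    exact ⟨fun i => h1 _, fun i j => h2 _ _⟩

/-- Bordering a square matrix by a column `v`, a row `-vᵀ` and a zero. -/
def alternatingBorder (v : κ → F) (M : Matrix κ κ F) : Matrix (Unit ⊕ κ) (Unit ⊕ κ) F :=
  fromBlocks 0 (-(replicateCol Unit v)ᵀ) (replicateCol Unit v) M

theorem alternatingBorder_of_isAlternating {M : Matrix (Unit ⊕ κ) (Unit ⊕ κ) F}
    (hM : IsAlternating M) :
    alternatingBorder (fun i => M (.inr i) (.inl ())) M.toBlocks₂₂ = M ∧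
      IsAlternating M.toBlocks₂₂ := by
  rw [← fromBlocks_toBlocks M, isAlternating_fromBlocks_iff, isAlternating_unit_iff] at hM
  refine ⟨?_, hM.2.2⟩
  conv_rhs => rw [← fromBlocks_toBlocks M, hM.1, hM.2.1]
  rfl

theorem IsAlternating.border {M : Matrix κ κ F} (hM : IsAlternating M) (v : κ → F) :
    IsAlternating (alternatingBorder v M) :=
  isAlternating_fromBlocks_iff.2 ⟨isAlternating_unit_iff.2 rfl, rfl, hM⟩

variable [Fintype κ]

theorem alternatingBorder_congruence (v : κ → F) (M g : Matrix κ κ F) :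
    alternatingBorder (g *ᵥ v) (g * M * gᵀ) =
      fromBlocks 1 0 0 g * alternatingBorder v M * (fromBlocks 1 0 0 g)ᵀ := by
  simp only [alternatingBorder, fromBlocks_transpose, fromBlocks_multiply, replicateCol_mulVec]
  simp [transpose_mul, Matrix.mul_assoc]

theorem IsAlternating.dotProduct_mulVec_self {M : Matrix κ κ F} (hM : IsAlternating M)
    (x : κ → F) : x ⬝ᵥ (M *ᵥ x) = 0 := by
  classical
  have h : x ⬝ᵥ (M *ᵥ x) = ∑ p : κ × κ, x p.1 * (M p.1 p.2 * x p.2) := by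
    simp only [dotProduct, mulVec, Finset.mul_sum]
    rw [← Finset.sum_product', Finset.univ_product_univ]
  rw [h]
  refine Finset.sum_involution (fun p _ => (p.2, p.1)) ?_ ?_ ?_ ?_
  · rintro ⟨i, j⟩ _
    simp only
    rw [hM.2 i j]
    ring
  · rintro ⟨i, j⟩ _ hne heq
    simp only [Prod.mk.injEq] at heq
    obtain ⟨rfl, -⟩ := heq
    simp [hM.1] at hne
  · intros; simp
  · intros; simp

variable [DecidableEq κ]

/-- The vectors eᵢ detect the diagonal and eᵢ + eⱼ the skew symmetry. In this form, invariance under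
congruence is immediate in every characteristic. -/
theorem isAlternating_of_dotProduct_mulVec_self {M : Matrix κ κ F}
    (h : ∀ x : κ → F, x ⬝ᵥ (M *ᵥ x) = 0) : IsAlternating M := by
  have h1 : ∀ i, M i i = 0 := fun i => by simpa using h (Pi.single i 1)
  refine ⟨h1, fun i j => ?_⟩
  have := h (Pi.single i 1 + Pi.single j 1)
  simp only [mulVec_add, add_dotProduct, dotProduct_add, mulVec_single_one, single_one_dotProduct,
    col_apply, h1] at this
  linear_combination this

theorem IsAlternating.congruence {M : Matrix κ κ F} (hM : IsAlternating M) (g : Matrix κ κ F) :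
    IsAlternating (g * M * gᵀ) := by
  refine isAlternating_of_dotProduct_mulVec_self fun x => ?_
  rw [← mulVec_mulVec, ← mulVec_mulVec, dotProduct_mulVec, ← mulVec_transpose]
  exact hM.dotProduct_mulVec_self _

/-- The group `GL` is transitive on nonzero vectors. -/
theorem exists_det_ne_zero_mulVec_single {v : κ → F} (hv : v ≠ 0) (i₀ : κ) :
    ∃ g : Matrix κ κ F, g.det ≠ 0 ∧ g *ᵥ Pi.single i₀ 1 = v := by
  obtain ⟨i, hi⟩ := Function.ne_iff.1 hv
  -- The identity with column i₀ replaced by the swapped v has determinant v i ≠ 0; the permutation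
  -- matrix then undoes the swap.
  refine ⟨(Equiv.swap i i₀).permMatrix F * updateCol 1 i₀ (v ∘ Equiv.swap i i₀), ?_, ?_⟩
  · rw [det_mul, det_permutation, ← cramer_apply, cramer_one]
    refine mul_ne_zero ?_ (by simpa using hi)
    rcases Int.units_eq_one_or (Equiv.Perm.sign (Equiv.swap i i₀)) with h | h <;> simp [h]
  · rw [← mulVec_mulVec, mulVec_single_one]
    have : (updateCol (1 : Matrix κ κ F) i₀ (v ∘ Equiv.swap i i₀)).col i₀ =
        v ∘ Equiv.swap i i₀ := by
      funext k; simp [col_apply]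
    rw [this, permMatrix_mulVec]
    funext k; simp

theorem det_alternatingBorder_zero (M : Matrix κ κ F) : (alternatingBorder 0 M).det = 0 := by
  refine det_eq_zero_of_row_eq_zero (.inl ()) ?_
  rintro (j | j) <;> simp [alternatingBorder]

variable (F κ) in
/-- The number of invertible alternating matrices. -/
noncomputable def altCount : ℕ :=
  Nat.card {M : Matrix κ κ F // IsAlternating M ∧ M.det ≠ 0}

theorem altCount_congr {ι : Type*} [Fintype ι] [DecidableEq ι] (e : ι ≃ κ) :
    altCount F ι = altCount F κ := by
  refine (Nat.card_congr ((Matrix.reindex e.symm e.symm).subtypeEquiv fun M => ?_)).symm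
  simp only [reindex_apply, Equiv.symm_symm]
  rw [isAlternating_submatrix_equiv, det_submatrix_equiv_self]

variable (κ) in
theorem altCount_of_isEmpty [IsEmpty κ] : altCount F κ = 1 := by
  rw [altCount, Nat.card_eq_one_iff_unique]
  exact ⟨⟨fun a b => Subtype.ext (Subsingleton.elim _ _)⟩,
    ⟨⟨0, ⟨fun i => isEmptyElim i, fun i => isEmptyElim i⟩, by simp⟩⟩⟩

/-- An invertible alternating matrix is a bordered alternating matrix. -/
def alternatingBorderEquiv : {M : Matrix (Unit ⊕ κ) (Unit ⊕ κ) F // IsAlternating M ∧ M.det ≠ 0} ≃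
    Σ v : κ → F, {M : Matrix κ κ F // IsAlternating M ∧ (alternatingBorder v M).det ≠ 0} where
  toFun M := ⟨fun i => M.1 (.inr i) (.inl ()), M.1.toBlocks₂₂, by
    obtain ⟨h1, h2⟩ := alternatingBorder_of_isAlternating M.2.1
    exact ⟨h2, by rw [h1]; exact M.2.2⟩⟩
  invFun x := ⟨alternatingBorder x.1 x.2.1, x.2.2.1.border _, x.2.2.2⟩
  left_inv M := Subtype.ext (alternatingBorder_of_isAlternating M.2.1).1
  right_inv x := rfl

/-- A kernel vector (a, b, y) of the doubly bordered matrix must have b = 0, a = w · y and M y = 0.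
Its kernel is therefore a copy of that of M, whatever w is. -/
theorem det_alternatingBorder_border (w : κ → F) (M : Matrix κ κ F) :
    (alternatingBorder (Sum.elim 1 0) (alternatingBorder w M)).det = 0 ↔ M.det = 0 := by
  have hmul : ∀ (a b : Unit → F) (y : κ → F),
      alternatingBorder (Sum.elim 1 0) (alternatingBorder w M) *ᵥ Sum.elim a (Sum.elim b y) = 0 ↔
      b () = 0 ∧ a () = w ⬝ᵥ y ∧ w * (fun _ => b ()) + M *ᵥ y = 0 := by
    intro a b y
    rw [funext_iff, Sum.forall, Sum.forall]
    refine and_congr ?_ (and_congr ?_ ?_)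
    · simp [alternatingBorder, mulVec, dotProduct]
    · simp [alternatingBorder, mulVec, dotProduct, ← sub_eq_add_neg, sub_eq_zero]
    · rw [funext_iff]
      simp [alternatingBorder, mulVec, dotProduct]
  rw [← exists_mulVec_eq_zero_iff, ← exists_mulVec_eq_zero_iff]
  constructor
  · rintro ⟨x, hx, h⟩
    have hxe : x = Sum.elim (fun i => x (.inl i)) (Sum.elim (fun i => x (.inr (.inl i)))
        fun i => x (.inr (.inr i))) := by
      funext i; rcases i with i | i | i <;> rfl
    rw [hxe, hmul] at h
    obtain ⟨h1, h2, h3⟩ := h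
    refine ⟨fun i => x (.inr (.inr i)), fun h0 => hx ?_, ?_⟩
    · rw [h0, dotProduct_zero] at h2
      funext i
      rcases i with i | i | i
      · exact h2
      · exact h1
      · exact congrFun h0 i
    · rw [h1] at h3
      rw [← h3]
      funext i
      simp [Pi.mul_apply]
  · rintro ⟨y, hy, h⟩
    refine ⟨Sum.elim (fun _ => w ⬝ᵥ y) (Sum.elim 0 y), fun h0 => hy ?_, ?_⟩
    · funext i
      exact congrFun h0 (.inr (.inr i))
    · rw [hmul]
      refine ⟨rfl, rfl, ?_⟩
      rw [h]
      funext i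
      simp

theorem card_alternatingBorder_elim :
    Nat.card {M : Matrix (Unit ⊕ κ) (Unit ⊕ κ) F // IsAlternating M ∧
      (alternatingBorder (Sum.elim 1 0) M).det ≠ 0} = Nat.card F ^ Fintype.card κ * altCount F κ := by
  have h : Nat.card F ^ Fintype.card κ = Nat.card (κ → F) := by
    rw [Nat.card_fun, Nat.card_eq_fintype_card (α := κ)]
  rw [h, altCount, ← Nat.card_prod]
  exact Nat.card_congr
    { toFun M := (fun i => M.1 (.inr i) (.inl ()), ⟨M.1.toBlocks₂₂, by
        obtain ⟨h1, h2⟩ := alternatingBorder_of_isAlternating M.2.1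
        have h := M.2.2
        rw [← h1, Ne, det_alternatingBorder_border] at h
        exact ⟨h2, h⟩⟩)
      invFun x := ⟨alternatingBorder x.1 x.2.1, x.2.2.1.border _,
        fun h => x.2.2.2 ((det_alternatingBorder_border _ _).1 h)⟩
      left_inv M := Subtype.ext (alternatingBorder_of_isAlternating M.2.1).1
      right_inv x := rfl }

variable [Finite F]

theorem card_alternatingBorder_le (v : κ → F) (g : Matrix κ κ F) (hg : g.det ≠ 0) :
    Nat.card {M : Matrix κ κ F // IsAlternating M ∧ (alternatingBorder v M).det ≠ 0} ≤
    Nat.card {M : Matrix κ κ F // IsAlternating M ∧ (alternatingBorder (g *ᵥ v) M).det ≠ 0} := by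
  have hu : IsUnit g := (isUnit_iff_isUnit_det _).2 hg.isUnit
  refine Nat.card_le_card_of_injective (fun M => ⟨g * M.1 * gᵀ, M.2.1.congruence g, ?_⟩) ?_
  · rw [alternatingBorder_congruence, det_mul, det_mul, det_transpose, det_fromBlocks_zero₂₁]
    simp [hg, M.2.2]
  · intro M M' h
    have h' := congrArg Subtype.val h
    simp only at h'
    have hu' : IsUnit gᵀ := (isUnit_transpose g).2 hu
    exact Subtype.ext (hu.mul_left_cancel (hu'.mul_right_cancel h'))

/-- Congruence carries the borders by v to those by g v, and GL is transitive on nonzero vectors. -/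
theorem card_alternatingBorder_eq {v w : κ → F} (hv : v ≠ 0) (hw : w ≠ 0) :
    Nat.card {M : Matrix κ κ F // IsAlternating M ∧ (alternatingBorder v M).det ≠ 0} =
    Nat.card {M : Matrix κ κ F // IsAlternating M ∧ (alternatingBorder w M).det ≠ 0} := by
  have key : ∀ {v w : κ → F}, v ≠ 0 → w ≠ 0 →
      Nat.card {M : Matrix κ κ F // IsAlternating M ∧ (alternatingBorder v M).det ≠ 0} ≤
      Nat.card {M : Matrix κ κ F // IsAlternating M ∧ (alternatingBorder w M).det ≠ 0} := by
    intro v w hv hw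
    obtain ⟨i, -⟩ := Function.ne_iff.1 hv
    obtain ⟨g, hg, rfl⟩ := exists_det_ne_zero_mulVec_single hv i
    obtain ⟨g', hg', rfl⟩ := exists_det_ne_zero_mulVec_single hw i
    have h := card_alternatingBorder_le (g *ᵥ Pi.single i 1) (g' * g⁻¹)
      (by rw [det_mul, det_nonsing_inv]; simp [hg, hg'])
    rwa [mulVec_mulVec, Matrix.mul_assoc, nonsing_inv_mul _ hg.isUnit, Matrix.mul_one] at h
  exact le_antisymm (key hv hw) (key hw hv)

/-- The first column below the corner is nonzero, and all its q^(|κ|+1) - 1 possible values are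
equally frequent. For the first basis vector the next border is free, and the remaining block is any
invertible alternating matrix. -/
theorem altCount_add_two :
    altCount F (Unit ⊕ (Unit ⊕ κ)) =
      Nat.card F ^ Fintype.card κ * (Nat.card F ^ (Fintype.card κ + 1) - 1) * altCount F κ := by
  classical
  have := Fintype.ofFinite F
  have h1 : altCount F (Unit ⊕ (Unit ⊕ κ)) = _ := Nat.card_congr alternatingBorderEquiv
  rw [h1, Nat.card_sigma, ← Finset.sum_erase Finset.univ (a := 0)]
  · have hne : (Sum.elim 1 0 : Unit ⊕ κ → F) ≠ 0 := fun h => by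
      simpa using congrFun h (.inl ())
    rw [Finset.sum_congr rfl fun v hv =>
      card_alternatingBorder_eq (Finset.ne_of_mem_erase hv) hne]
    rw [Finset.sum_const, Finset.card_erase_of_mem (Finset.mem_univ _), Finset.card_univ,
      card_alternatingBorder_elim]
    simp only [Fintype.card_pi, Finset.prod_const, Finset.card_univ, Fintype.card_sum,
      Fintype.card_unit, Nat.card_eq_fintype_card, smul_eq_mul]
    rw [add_comm 1]
    ring
  · rw [Nat.card_eq_zero]
    exact Or.inl ⟨fun M => M.2.2 (det_alternatingBorder_zero _)⟩

/-- The number of invertible alternating matrices of size `2k`. -/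
theorem altCount_fin_two_mul (k : ℕ) :
    altCount F (Fin (2 * k)) = Nat.card F ^ (k * (k - 1)) *
      ∏ j ∈ Finset.Icc 1 k, (Nat.card F ^ (2 * j - 1) - 1) := by
  induction k with
  | zero => simpa using altCount_of_isEmpty (F := F) (Fin 0)
  | succ k ih =>
    have e : Fin (2 * (k + 1)) ≃ Unit ⊕ (Unit ⊕ Fin (2 * k)) :=
      Fintype.equivOfCardEq (by simp; ring)
    rw [altCount_congr e, altCount_add_two, ih, Finset.prod_Icc_succ_top (by omega),
      Fintype.card_fin]
    have h1 : (k + 1) * (k + 1 - 1) = 2 * k + k * (k - 1) := by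
      rcases k with _ | k
      · rfl
      · simp only [Nat.add_sub_cancel]; ring
    have h2 : 2 * (k + 1) - 1 = 2 * k + 1 := by omega
    rw [h1, h2, pow_add]
    ring

end Alternating

/-! ### The parabolic subgroup as a stabiliser -/

section Parabolic

variable {n : ℕ} {F : Type*} [Field F]

theorem leviMatrix_mul_unipotentMatrix (A : GL (Fin n) F) (B : Matrix (Fin n) (Fin n) F)
    (h : Matrix Unit (Fin n) F) :
    leviMatrix A * unipotentMatrix B h =
      fromBlocks (fromBlocks A.1 (A.1 * B) 0 (A⁻¹).1ᵀ) 0 (fromCols 0 h) 1 := by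
  simp [leviMatrix, unipotentMatrix, fromBlocks_multiply]

theorem theta_elim (a b : Fin n → F) (c : Unit → F) :
    theta n (Sum.elim (Sum.elim a b) c) = a ⬝ᵥ b + c () ^ 2 := rfl

variable [CharP F 2]

/-- The polar form of `θ` is preserved by isometries. -/
theorem polar_of_mem_orthGroup {w : GL (OIdx n) F} (hw : w ∈ orthGroup n F)
    {a b a' b' y z y' z' : Fin n → F} {c c' t t' : Unit → F}
    (h : w.1 *ᵥ Sum.elim (Sum.elim a b) c = Sum.elim (Sum.elim y z) t)
    (h' : w.1 *ᵥ Sum.elim (Sum.elim a' b') c' = Sum.elim (Sum.elim y' z') t') :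
    y ⬝ᵥ z' + y' ⬝ᵥ z = a ⬝ᵥ b' + a' ⬝ᵥ b := by
  have e : ∀ (a b a' b' : Fin n → F) (c c' : Unit → F),
      Sum.elim (Sum.elim a b) c + Sum.elim (Sum.elim a' b') c' =
      Sum.elim (Sum.elim (a + a') (b + b')) (c + c') := by
    intro a b a' b' c c'
    funext i; rcases i with (i | i) | i <;> rfl
  have h1 := hw (Sum.elim (Sum.elim a b) c)
  have h2 := hw (Sum.elim (Sum.elim a' b') c')
  have h3 := hw (Sum.elim (Sum.elim a b) c + Sum.elim (Sum.elim a' b') c')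
  rw [mulVec_add] at h3
  rw [h] at h1 h3
  rw [h'] at h2 h3
  simp only [e, theta_elim, add_dotProduct, dotProduct_add, Pi.add_apply] at h1 h2 h3
  have h4 : (2 : F) = 0 := CharTwo.two_eq_zero
  linear_combination h3 - h1 - h2 - (t () * t' () - c () * c' ()) * h4

/-- The parabolic subgroup is the stabiliser of the span of the first `n` basis vectors. -/
theorem mem_parabolic_iff (w : GL (OIdx n) F) :
    w ∈ parabolic n F ↔ w ∈ orthGroup n F ∧
      (∀ i j, w.1 (.inl (.inr i)) (.inl (.inl j)) = 0) ∧ ∀ j, w.1 (.inr ()) (.inl (.inl j)) = 0 := by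
  constructor
  · intro hw
    refine ⟨parabolic_subset_orthGroup n F hw, ?_⟩
    obtain ⟨A, B, h, -, hw⟩ := hw
    rw [hw, leviMatrix_mul_unipotentMatrix]
    exact ⟨fun i j => rfl, fun j => rfl⟩
  · rintro ⟨hw, h1, h2⟩
    obtain ⟨a, b, d, e, f, h, t, hblk⟩ : ∃ (a b d : Matrix (Fin n) (Fin n) F)
        (e f : Matrix (Fin n) Unit F) (h : Matrix Unit (Fin n) F) (t : Matrix Unit Unit F),
        w.1 = fromBlocks (fromBlocks a b 0 d) (fromRows e f) (fromCols 0 h) t := by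
      refine ⟨w.1.toBlocks₁₁.toBlocks₁₁, w.1.toBlocks₁₁.toBlocks₁₂, w.1.toBlocks₁₁.toBlocks₂₂,
        w.1.toBlocks₁₂.toRows₁, w.1.toBlocks₁₂.toRows₂, w.1.toBlocks₂₁.toCols₂,
        w.1.toBlocks₂₂, ?_⟩
      ext ((i | i) | i) ((j | j) | j)
      all_goals first | rfl | exact h1 i j | exact h2 j
    have hact : ∀ (x y : Fin n → F) (z : Unit → F), w.1 *ᵥ Sum.elim (Sum.elim x y) z =
        Sum.elim (Sum.elim (a *ᵥ x + b *ᵥ y + e *ᵥ z) (d *ᵥ y + f *ᵥ z)) (h *ᵥ y + t *ᵥ z) := by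
      intro x y z
      rw [hblk]
      simp only [fromBlocks_mulVec, Sum.elim_comp_inl, Sum.elim_comp_inr, fromRows_mulVec,
        fromCols_mulVec, zero_mulVec, zero_add]
      congr 1
      funext i; rcases i with i | i <;> simp
    have had : aᵀ * d = 1 := by
      have key : ∀ x y, (a *ᵥ x) ⬝ᵥ (d *ᵥ y) = x ⬝ᵥ y := fun x y => by
        simpa using polar_of_mem_orthGroup hw (hact x 0 0) (hact 0 y 0)
      ext i j
      have := key (Pi.single i 1) (Pi.single j 1)
      rw [mulVec_single_one, mulVec_single_one] at this
      rw [mul_apply']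
      refine Eq.trans this ?_
      simp [Matrix.one_apply, Pi.single_apply, eq_comm]
    have hda : d * aᵀ = 1 := mul_eq_one_comm.1 had
    -- The last basis vector is in the radical of the polar form, so its image pairs to zero with
    -- the images of the others. Invertibility of `a` and `d` then kills `f` and `e`.
    have hf : f = 0 := by
      have key : ∀ x z, (a *ᵥ x) ⬝ᵥ (f *ᵥ z) = 0 := fun x z => by
        simpa using polar_of_mem_orthGroup hw (hact x 0 0) (hact 0 0 z)
      have h0 : aᵀ * f = 0 := by
        ext i j
        have := key (Pi.single i 1) (Pi.single j 1)
        rwa [mulVec_single_one, mulVec_single_one] at this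
      rw [← Matrix.one_mul f, ← hda, Matrix.mul_assoc, h0, Matrix.mul_zero]
    subst hf
    have he : e = 0 := by
      have key : ∀ y z, (e *ᵥ z) ⬝ᵥ (d *ᵥ y) = 0 := fun y z => by
        simpa using polar_of_mem_orthGroup hw (hact 0 y 0) (hact 0 0 z)
      have h0 : eᵀ * d = 0 := by
        ext i j
        have := key (Pi.single j 1) (Pi.single i 1)
        rwa [mulVec_single_one, mulVec_single_one] at this
      rw [← transpose_eq_zero, ← Matrix.mul_one eᵀ, ← hda, ← Matrix.mul_assoc, h0, Matrix.zero_mul]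
    subst he
    have ht : t = 1 := by
      have := hw (Sum.elim (Sum.elim 0 0) 1)
      rw [hact, theta_elim, theta_elim] at this
      have h3 : t () () ^ 2 = 1 := by simpa [mulVec, dotProduct] using this
      have h4 : (2 : F) = 0 := CharTwo.two_eq_zero
      have h5 : (t () () - 1) ^ 2 = 0 := by linear_combination h3 - (t () () - 1) * h4
      ext i j
      exact sub_eq_zero.1 ((pow_eq_zero_iff two_ne_zero).1 h5)
    subst ht
    have hdta : dᵀ * a = 1 := by rw [← transpose_inj]; simpa using had
    refine ⟨⟨a, dᵀ, mul_eq_one_comm.1 hdta, hdta⟩, dᵀ * b, h, ?_, ?_⟩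
    -- The form θ vanishes on the middle block of coordinates, and its value on the image of y is
    -- the quadratic form of dᵀb + hᵀh.
    · refine isAlternating_of_dotProduct_mulVec_self fun y => ?_
      have := hw (Sum.elim (Sum.elim 0 y) 0)
      rw [hact, theta_elim, theta_elim] at this
      have h3 : (b *ᵥ y) ⬝ᵥ (d *ᵥ y) + (h *ᵥ y) () ^ 2 = 0 := by simpa using this
      rw [add_mulVec, dotProduct_add, ← mulVec_mulVec, ← mulVec_mulVec, dotProduct_mulVec y hᵀ,
        dotProduct_mulVec y dᵀ, vecMul_transpose, vecMul_transpose, dotProduct_comm, ← h3]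
      simp [dotProduct, sq]
    · have hb : a * (dᵀ * b) = b := by
        rw [← Matrix.mul_assoc, mul_eq_one_comm.1 hdta, Matrix.one_mul]
      rw [leviMatrix_mul_unipotentMatrix, hblk]
      simp only [hb, Units.inv_mk, transpose_transpose]
      congr 1
      ext (i | i) j <;> rfl

theorem one_mem_parabolic : (1 : GL (OIdx n) F) ∈ parabolic n F :=
  (mem_parabolic_iff _).2 ⟨one_mem _, fun _ _ => rfl, fun _ => rfl⟩

theorem mul_mem_parabolic {v w : GL (OIdx n) F} (hv : v ∈ parabolic n F)
    (hw : w ∈ parabolic n F) : v * w ∈ parabolic n F := by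
  rw [mem_parabolic_iff] at hv hw ⊢
  refine ⟨mul_mem hv.1 hw.1, ?_, ?_⟩
  · intro i j
    simp [Matrix.mul_apply, Fintype.sum_sum_type, hv.2.1, hw.2.1, hw.2.2]
  · intro j
    simp [Matrix.mul_apply, Fintype.sum_sum_type, hv.2.2, hw.2.1, hw.2.2]

variable (n F) in
/-- The parabolic set as a subgroup. -/
def parabolicSubgroup [Finite F] : Subgroup (GL (OIdx n) F) where
  carrier := parabolic n F
  one_mem' := one_mem_parabolic
  mul_mem' := mul_mem_parabolic
  inv_mem' := by
    intro w hw
    -- The ambient group is finite, so inverses are powers.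
    have hpow : ∀ k : ℕ, w ^ k ∈ parabolic n F := by
      intro k
      induction k with
      | zero => simpa using one_mem_parabolic
      | succ k ih => rw [pow_succ]; exact mul_mem_parabolic ih hw
    have : w⁻¹ = w ^ (orderOf w - 1) := by
      rw [inv_eq_iff_mul_eq_one, ← pow_succ', Nat.sub_add_cancel (orderOf_pos w),
        pow_orderOf_eq_one]
    rw [this]
    exact hpow _

end Parabolic

/-! ### Coordinates (A, B) on the parabolic subgroup -/

section Parametrization

variable {F : Type*} [Field F]

variable (F) in
/-- The space of symmetric matrices. -/
def symmSubmodule (κ : Type*) : Submodule F (Matrix κ κ F) where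
  carrier := {B | Bᵀ = B}
  add_mem' := fun {a b} (ha : aᵀ = a) (hb : bᵀ = b) => show (a + b)ᵀ = a + b by
    rw [transpose_add, ha, hb]
  zero_mem' := transpose_zero
  smul_mem' := fun c {a} (ha : aᵀ = a) => show (c • a)ᵀ = c • a by rw [transpose_smul, ha]

theorem symmSubmodule_apply {κ : Type*} (B : symmSubmodule F κ) (i j : κ) :
    B.1 i j = B.1 j i := congrFun (congrFun B.2 j) i

theorem trace_fromBlocks_eq_add {ι κ : Type*} [Fintype ι] [Fintype κ] (a : Matrix ι ι F)
    (b : Matrix ι κ F) (c : Matrix κ ι F) (d : Matrix κ κ F) :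
    (fromBlocks a b c d).trace = a.trace + d.trace := by
  simp [trace, Fintype.sum_sum_type]

variable {n m : ℕ}

/-- Inverses of lower block triangular matrices have the same shape, with inverse diagonal blocks.
The corner entry is the source of d + d⁻¹. -/
theorem inv_of_last_column_eq_zero (A : GL (Fin (m + 1)) F)
    (hA : ∀ i : Fin m, A.1 i.castSucc (Fin.last m) = 0) :
    (A⁻¹).1.submatrix Fin.castSucc Fin.castSucc * A.1.submatrix Fin.castSucc Fin.castSucc = 1 ∧
      (∀ i : Fin m, (A⁻¹).1 i.castSucc (Fin.last m) = 0) ∧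
      (A⁻¹).1 (Fin.last m) (Fin.last m) * A.1 (Fin.last m) (Fin.last m) = 1 := by
  have h1 : A.1 * (A⁻¹).1 = 1 := by rw [← Units.val_mul]; simp
  have h2 : (A⁻¹).1 * A.1 = 1 := by rw [← Units.val_mul]; simp
  generalize (A⁻¹).1 = X at h1 h2 ⊢
  generalize A.1 = A at h1 h2 hA ⊢
  have h3 : A.submatrix Fin.castSucc Fin.castSucc * X.submatrix Fin.castSucc Fin.castSucc = 1 := by
    ext i j
    have := congrFun (congrFun h1 i.castSucc) j.castSucc
    rw [mul_apply, Fin.sum_univ_castSucc, hA, zero_mul, add_zero] at this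
    rw [mul_apply]
    simpa [Matrix.one_apply] using this
  have h4 := mul_eq_one_comm.1 h3
  refine ⟨h4, ?_, ?_⟩
  · have h5 : A.submatrix Fin.castSucc Fin.castSucc *ᵥ (fun i => X i.castSucc (Fin.last m)) = 0 := by
      funext i
      have := congrFun (congrFun h1 i.castSucc) (Fin.last m)
      rw [mul_apply, Fin.sum_univ_castSucc, hA, zero_mul, add_zero,
        one_apply_ne (Fin.castSucc_lt_last i).ne] at this
      exact this
    have h6 := congrArg (fun v => X.submatrix Fin.castSucc Fin.castSucc *ᵥ v) h5
    simp only [mulVec_mulVec, h4, one_mulVec, mulVec_zero] at h6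
    exact congrFun h6
  · have := congrFun (congrFun h2 (Fin.last m)) (Fin.last m)
    rw [mul_apply, Fin.sum_univ_castSucc] at this
    simpa [hA] using this

variable [Finite F] [CharP F 2]

/-- The row vector of square roots of the diagonal entries. -/
noncomputable def sqrtDiag (B : Matrix (Fin n) (Fin n) F) : Matrix Unit (Fin n) F :=
  fun _ i => (frobeniusEquiv F 2).symm (B i i)

theorem sqrtDiag_sq (B : Matrix (Fin n) (Fin n) F) (i : Fin n) :
    sqrtDiag B () i ^ 2 = B i i := by
  rw [sqrtDiag, ← frobenius_def, ← coe_frobeniusEquiv, RingEquiv.apply_symm_apply]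

theorem isAltMatrix_add_sqrtDiag (B : symmSubmodule F (Fin n)) :
    IsAltMatrix (B.1 + (sqrtDiag B.1)ᵀ * sqrtDiag B.1) := by
  have h : ∀ i j, (B.1 + (sqrtDiag B.1)ᵀ * sqrtDiag B.1) i j =
      B.1 i j + sqrtDiag B.1 () i * sqrtDiag B.1 () j := by
    intro i j
    simp [Matrix.mul_apply]
  refine ⟨fun i => ?_, fun i j => ?_⟩
  · rw [h, ← sq, sqrtDiag_sq, CharTwo.add_self_eq_zero]
  · rw [h, h, CharTwo.neg_eq, symmSubmodule_apply B i j, mul_comm]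

/-- In characteristic two the off-diagonal condition is symmetry of B, as hᵀh is symmetric. The
diagonal says hᵢ² = Bᵢᵢ, which determines h because squaring is injective. -/
theorem symm_and_sqrtDiag_of_isAltMatrix {B : Matrix (Fin n) (Fin n) F}
    {h : Matrix Unit (Fin n) F} (hB : IsAltMatrix (B + hᵀ * h)) :
    B ∈ symmSubmodule F (Fin n) ∧ sqrtDiag B = h := by
  have he : ∀ i j, (B + hᵀ * h) i j = B i j + h () i * h () j := by
    intro i j
    simp [Matrix.mul_apply]
  constructor
  · show Bᵀ = B
    ext i j
    have := hB.2 j i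
    rw [he, he, CharTwo.neg_eq, mul_comm (h () i)] at this
    exact add_right_cancel this
  · ext u i
    have := hB.1 i
    rw [he, ← sq, ← sqrtDiag_sq B i, ← CharTwo.sub_eq_add, sub_eq_zero] at this
    exact frobenius_inj F 2 this

/-- The element of the parabolic subgroup with parameters `A`, `B`. -/
noncomputable def parabolicElt (A : GL (Fin n) F) (B : symmSubmodule F (Fin n)) :
    GL (OIdx n) F :=
  GeneralLinearGroup.mkOfDetNeZero (leviMatrix A * unipotentMatrix B.1 (sqrtDiag B.1)) (by
    rw [leviMatrix_mul_unipotentMatrix, det_fromBlocks_zero₁₂, det_fromBlocks_zero₂₁,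
      det_transpose, ← det_mul, ← Units.val_mul]
    simp)

theorem parabolicElt_val (A : GL (Fin n) F) (B : symmSubmodule F (Fin n)) :
    (parabolicElt A B).1 =
      fromBlocks (fromBlocks A.1 (A.1 * B.1) 0 (A⁻¹).1ᵀ) 0 (fromCols 0 (sqrtDiag B.1)) 1 :=
  leviMatrix_mul_unipotentMatrix _ _ _

variable (n F) in
/-- The parabolic subgroup is parametrised by `GL` and the symmetric matrices. -/
noncomputable def parabolicEquiv :
    GL (Fin n) F × symmSubmodule F (Fin n) ≃ parabolicSubgroup n F :=
  Equiv.ofBijective (fun x => ⟨parabolicElt x.1 x.2,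
    ⟨x.1, x.2.1, sqrtDiag x.2.1, isAltMatrix_add_sqrtDiag x.2, rfl⟩⟩) <| by
    constructor
    · rintro ⟨A, B⟩ ⟨A', B'⟩ h
      have h := congrArg (fun w : parabolicSubgroup n F => w.1.1) h
      simp only [parabolicElt_val, fromBlocks_inj] at h
      obtain ⟨⟨h1, h2, -, -⟩, -⟩ := h
      have hA : A = A' := Units.ext h1
      subst hA
      have hB : B.1 = B'.1 := A.isUnit.mul_left_cancel h2
      exact Prod.ext rfl (Subtype.ext hB)
    · rintro ⟨w, A, B, h, hB, hw⟩
      obtain ⟨h1, h2⟩ := symm_and_sqrtDiag_of_isAltMatrix hB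
      refine ⟨(A, ⟨B, h1⟩), Subtype.ext (Units.ext ?_)⟩
      rw [hw, ← h2]
      rfl

theorem parabolicEquiv_val (x : GL (Fin n) F × symmSubmodule F (Fin n)) :
    (parabolicEquiv F n x).1.1 = fromBlocks (fromBlocks x.1.1 (x.1.1 * x.2.1) 0 (x.1⁻¹).1ᵀ) 0
      (fromCols 0 (sqrtDiag x.2.1)) 1 :=
  parabolicElt_val _ _

/-- With D = diag(1,…,1,0), the diagonal blocks of the product are (1 - D)A, DAB + (1 - D)ᵗA⁻¹ and
1. -/
theorem trace_sigma_mul_parabolicEquiv (x : GL (Fin (m + 1)) F × symmSubmodule F (Fin (m + 1))) :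
    (sigmaElt (m + 1) m F * (parabolicEquiv F (m + 1) x).1).1.trace =
      1 + x.1.1 (Fin.last m) (Fin.last m) + (x.1⁻¹).1 (Fin.last m) (Fin.last m) +
      (diagonal (fun i : Fin (m + 1) => if i.1 < m then 1 else 0) * x.1.1 * x.2.1).trace := by
  rw [Units.val_mul, parabolicEquiv_val]
  generalize (x.1⁻¹).1 = E
  generalize x.1.1 = A
  have h : ∀ M : Matrix (Fin (m + 1)) (Fin (m + 1)) F,
      (diagonal (fun i : Fin (m + 1) => if i.1 < m then (0 : F) else 1) * M).trace =
        M (Fin.last m) (Fin.last m) := by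
    intro M
    simp [trace, Fin.sum_univ_castSucc, diagonal_mul]
  simp only [sigmaElt, sigmaMatrix, fromBlocks_multiply, trace_fromBlocks_eq_add,
    Matrix.mul_zero, Matrix.zero_mul, add_zero, trace_add, h, transpose_apply, Matrix.mul_assoc,
    trace_one, trace_zero, Matrix.mul_one, Fintype.card_unit, Nat.cast_one]
  ring

/-- The conjugate is an isometry already, so only the two zero blocks of `mem_parabolic_iff` have to
be tested. Once A is block triangular, its top block is invertible and can be cancelled from the
condition on AB. -/
theorem sigma_conj_mem_iff (x : GL (Fin (m + 1)) F × symmSubmodule F (Fin (m + 1))) :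
    (sigmaElt (m + 1) m F)⁻¹ * (parabolicEquiv F (m + 1) x).1 * sigmaElt (m + 1) m F ∈
        parabolicSubgroup (m + 1) F ↔
      (∀ i : Fin m, x.1.1 i.castSucc (Fin.last m) = 0) ∧
        ∀ i j : Fin m, x.2.1 i.castSucc j.castSucc = 0 := by
  set w := (sigmaElt (m + 1) m F)⁻¹ * (parabolicEquiv F (m + 1) x).1 * sigmaElt (m + 1) m F with hw
  have horth : w ∈ orthGroup (m + 1) F := by
    have h1 := sigmaElt_mem_orthGroup (m + 1) m F
    have h2 := parabolic_subset_orthGroup (m + 1) F (parabolicEquiv F (m + 1) x).2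
    exact mul_mem (mul_mem (inv_mem h1) h2) h1
  have hval : w.1 = sigmaMatrix (m + 1) m F * (fromBlocks (fromBlocks x.1.1 (x.1.1 * x.2.1) 0
      (x.1⁻¹).1ᵀ) 0 (fromCols 0 (sqrtDiag x.2.1)) 1) * sigmaMatrix (m + 1) m F := by
    rw [hw, Units.val_mul, Units.val_mul, parabolicEquiv_val]
    rfl
  have hmem : w ∈ parabolicSubgroup (m + 1) F ↔ w ∈ parabolic (m + 1) F := Iff.rfl
  rw [hmem, mem_parabolic_iff, and_iff_right horth, hval]
  have hinv := inv_of_last_column_eq_zero x.1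
  have hB := sqrtDiag_sq x.2.1
  generalize sqrtDiag x.2.1 = h at hB
  generalize (x.1⁻¹).1 = X at hinv
  generalize x.1.1 = A at hinv
  generalize x.2.1 = B at hB
  simp only [sigmaMatrix, fromBlocks_multiply, fromBlocks_apply₁₁, fromBlocks_apply₂₁,
    Matrix.mul_zero, Matrix.zero_mul, add_zero, zero_add, Matrix.one_mul, fromCols_mul_fromBlocks,
    fromCols_apply_inl, Matrix.add_mul, Matrix.add_apply, mul_diagonal, diagonal_mul,
    transpose_apply]
  have hE : (∀ i j : Fin (m + 1), ((if i.1 < m then (1 : F) else 0) * A i j) *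
      (if j.1 < m then 0 else 1) + ((if i.1 < m then 1 else 0) * (A * B) i j *
      (if j.1 < m then 1 else 0) + (if i.1 < m then 0 else 1) * X j i *
      (if j.1 < m then 1 else 0)) = 0) ↔ (∀ i : Fin m, A i.castSucc (Fin.last m) = 0) ∧
      (∀ i j : Fin m, (A * B) i.castSucc j.castSucc = 0) ∧
      ∀ i : Fin m, X i.castSucc (Fin.last m) = 0 := by
    simp only [Fin.forall_fin_succ']
    simp [forall_and]
    tauto
  have hH : (∀ j : Fin (m + 1), h () j * (if j.1 < m then (1 : F) else 0) = 0) ↔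
      ∀ j : Fin m, h () j.castSucc = 0 := by
    simp [Fin.forall_fin_succ']
  rw [hE, hH]
  have hC : (∀ i : Fin m, A i.castSucc (Fin.last m) = 0) → ∀ i j : Fin m,
      (A * B) i.castSucc j.castSucc = (A.submatrix Fin.castSucc Fin.castSucc *
        B.submatrix Fin.castSucc Fin.castSucc) i j := by
    intro hA i j
    rw [mul_apply, mul_apply, Fin.sum_univ_castSucc, hA, zero_mul, add_zero]
    rfl
  constructor
  · rintro ⟨⟨h1, h2, -⟩, -⟩
    refine ⟨h1, ?_⟩
    have h3 : A.submatrix Fin.castSucc Fin.castSucc *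
        B.submatrix Fin.castSucc Fin.castSucc = 0 := by
      ext i j
      rw [← hC h1, h2]; rfl
    have h4 := congrArg (fun M => X.submatrix Fin.castSucc Fin.castSucc * M) h3
    simp only [← Matrix.mul_assoc, (hinv h1).1, Matrix.one_mul, Matrix.mul_zero] at h4
    exact fun i j => congrFun (congrFun h4 i) j
  · rintro ⟨h1, h2⟩
    refine ⟨⟨h1, fun i j => ?_, (hinv h1).2.1⟩, fun j => ?_⟩
    · rw [hC h1, mul_apply]
      exact Finset.sum_eq_zero fun k _ => by rw [submatrix_apply B, h2, mul_zero]
    -- The condition on h is implied, since hⱼ² = Bⱼⱼ = 0.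
    · have := hB j.castSucc
      rw [h2] at this
      exact (pow_eq_zero_iff two_ne_zero).1 this

end Parametrization

/-! ### Symmetric matrices, block triangular matrices and the trace functional -/

section Counting

variable {F : Type*} [Field F] {n m : ℕ}

/-- Symmetric matrices are functions on unordered pairs of indices. -/
def symmSubmoduleEquiv (κ : Type*) : symmSubmodule F κ ≃ (Sym2 κ → F) where
  toFun B := Sym2.lift ⟨fun i j => B.1 i j, symmSubmodule_apply B⟩
  invFun f := ⟨Matrix.of fun i j => f s(i, j), by
    show transpose _ = _
    ext i j
    rw [transpose_apply, of_apply, of_apply, Sym2.eq_swap]⟩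
  left_inv B := rfl
  right_inv f := by
    funext z
    induction z with
    | _ i j => rfl

theorem card_symmSubmodule :
    Nat.card (symmSubmodule F (Fin n)) = Nat.card F ^ ((n + 1).choose 2) := by
  rw [Nat.card_congr (symmSubmoduleEquiv _), Nat.card_fun, Nat.card_eq_fintype_card (α := Sym2 _),
    Sym2.card, Fintype.card_fin]

/-- Symmetric matrices supported on the last row and column. -/
def symmSubmoduleLastEquiv : {B : symmSubmodule F (Fin (m + 1)) //
    ∀ i j : Fin m, B.1 i.castSucc j.castSucc = 0} ≃ (Fin (m + 1) → F) where
  toFun B i := B.1.1 i (Fin.last m)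
  invFun v := ⟨⟨Matrix.of fun i j =>
      if j = Fin.last m then v i else if i = Fin.last m then v j else 0, by
    show transpose _ = _
    ext i j
    rw [transpose_apply, of_apply, of_apply]
    split_ifs with h1 h2 <;> simp [*]⟩, fun i j => by
    simp [(Fin.castSucc_lt_last _).ne]⟩
  left_inv B := by
    apply Subtype.ext
    apply Subtype.ext
    ext i j
    simp only [of_apply]
    split_ifs with h1 h2
    · rw [h1]
    · rw [h2, symmSubmodule_apply]
    · obtain ⟨i, rfl⟩ := Fin.exists_castSucc_eq.2 h2
      obtain ⟨j, rfl⟩ := Fin.exists_castSucc_eq.2 h1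
      exact (B.2 i j).symm
  right_inv v := by
    funext i
    simp

theorem card_symmSubmodule_last : Nat.card {B : symmSubmodule F (Fin (m + 1)) //
    ∀ i j : Fin m, B.1 i.castSucc j.castSucc = 0} = Nat.card F ^ (m + 1) := by
  rw [Nat.card_congr symmSubmoduleLastEquiv, Nat.card_fun, Nat.card_eq_fintype_card (α := Fin _),
    Fintype.card_fin]

/-- The block lower triangular matrix `[M 0; u d]`. -/
def lowerBlock (M : Matrix (Fin m) (Fin m) F) (u : Fin m → F) (d : F) :
    Matrix (Fin (m + 1)) (Fin (m + 1)) F :=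
  (fromBlocks M 0 (replicateRow (Fin 1) u) (diagonal fun _ => d)).submatrix finSumFinEquiv.symm
    finSumFinEquiv.symm

section
variable (M : Matrix (Fin m) (Fin m) F) (u : Fin m → F) (d : F)

theorem det_lowerBlock : (lowerBlock M u d).det = M.det * d := by
  rw [lowerBlock, det_submatrix_equiv_self, det_fromBlocks_zero₁₂]
  simp

theorem lowerBlock_castSucc_castSucc (i j : Fin m) :
    lowerBlock M u d i.castSucc j.castSucc = M i j := by
  simp [lowerBlock]

theorem lowerBlock_castSucc_last (i : Fin m) :
    lowerBlock M u d i.castSucc (Fin.last m) = 0 := by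
  simp [lowerBlock]

theorem lowerBlock_last_castSucc (j : Fin m) :
    lowerBlock M u d (Fin.last m) j.castSucc = u j := by
  simp [lowerBlock]

theorem lowerBlock_last_last : lowerBlock M u d (Fin.last m) (Fin.last m) = d := by
  simp [lowerBlock]

theorem lowerBlock_submatrix :
    (lowerBlock M u d).submatrix Fin.castSucc Fin.castSucc = M := by
  ext i j
  exact lowerBlock_castSucc_castSucc _ _ _ _ _

/-- The invertible matrix `[M 0; u d]`. -/
noncomputable def lowerBlockGL (hM : M.det ≠ 0) (d : Fˣ) : GL (Fin (m + 1)) F :=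
  GeneralLinearGroup.mkOfDetNeZero (lowerBlock M u d)
    (by rw [det_lowerBlock]; exact mul_ne_zero hM d.ne_zero)

theorem lowerBlockGL_inv_last (hM : M.det ≠ 0) (d : Fˣ) :
    ((lowerBlockGL M u hM d)⁻¹).1 (Fin.last m) (Fin.last m) = (d⁻¹ : Fˣ) := by
  have h := (inv_of_last_column_eq_zero (lowerBlockGL M u hM d)
    (lowerBlock_castSucc_last M u d)).2.2
  have h1 : (lowerBlockGL M u hM d).1 (Fin.last m) (Fin.last m) = d := lowerBlock_last_last _ _ _
  rw [h1] at h
  rw [Units.val_inv_eq_inv_val, eq_comm, inv_eq_of_mul_eq_one_left h]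

end

/-- Invertible matrices with last column zero above the corner. -/
noncomputable def lowerBlockEquiv (Q : Matrix (Fin m) (Fin m) F → Prop) (T : F → F → Prop) :
    {A : GL (Fin (m + 1)) F // (∀ i : Fin m, A.1 i.castSucc (Fin.last m) = 0) ∧
      Q (A.1.submatrix Fin.castSucc Fin.castSucc) ∧
      T (A.1 (Fin.last m) (Fin.last m)) ((A⁻¹).1 (Fin.last m) (Fin.last m))} ≃
    {M : Matrix (Fin m) (Fin m) F // Q M ∧ M.det ≠ 0} × (Fin m → F) ×
      {d : Fˣ // T d (d⁻¹ : Fˣ)} where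
  toFun A :=
    have h := inv_of_last_column_eq_zero A.1 A.2.1
    (⟨A.1.1.submatrix Fin.castSucc Fin.castSucc, A.2.2.1, det_ne_zero_of_left_inverse h.1⟩,
      fun j => A.1.1 (Fin.last m) j.castSucc,
      ⟨⟨A.1.1 (Fin.last m) (Fin.last m), (A.1⁻¹).1 (Fin.last m) (Fin.last m),
        (mul_comm _ _).trans h.2.2, h.2.2⟩, A.2.2.2⟩)
  invFun x := ⟨lowerBlockGL x.1.1 x.2.1 x.1.2.2 x.2.2.1, lowerBlock_castSucc_last _ _ _,
    (congrArg Q (lowerBlock_submatrix _ _ _)).mpr x.1.2.1,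
    (congrArg₂ T (lowerBlock_last_last _ _ _) (lowerBlockGL_inv_last _ _ _ _)).mpr x.2.2.2⟩
  left_inv A := by
    apply Subtype.ext
    apply Units.ext
    show lowerBlock _ _ _ = A.1.1
    ext i j
    induction i using Fin.lastCases with
    | last =>
      induction j using Fin.lastCases with
      | last => exact lowerBlock_last_last _ _ _
      | cast j => exact lowerBlock_last_castSucc _ _ _ _
    | cast i =>
      induction j using Fin.lastCases with
      | last => exact (lowerBlock_castSucc_last _ _ _ _).trans (A.2.1 i).symm
      | cast j => exact lowerBlock_castSucc_castSucc _ _ _ _ _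
  right_inv x := by
    refine Prod.ext (Subtype.ext ?_) (Prod.ext ?_ (Subtype.ext (Units.ext ?_)))
    · exact lowerBlock_submatrix _ _ _
    · funext j
      exact lowerBlock_last_castSucc _ _ _ _
    · exact lowerBlock_last_last _ _ _

/-- Applied with trivial conditions to P ∩ σPσ⁻¹, and with Q alternating to the matrices A whose
trace functional vanishes. -/
theorem card_lowerBlock (Q : Matrix (Fin m) (Fin m) F → Prop) (T : F → F → Prop) :
    Nat.card {A : GL (Fin (m + 1)) F // (∀ i : Fin m, A.1 i.castSucc (Fin.last m) = 0) ∧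
      Q (A.1.submatrix Fin.castSucc Fin.castSucc) ∧
      T (A.1 (Fin.last m) (Fin.last m)) ((A⁻¹).1 (Fin.last m) (Fin.last m))} =
    Nat.card {M : Matrix (Fin m) (Fin m) F // Q M ∧ M.det ≠ 0} * Nat.card F ^ m *
      Nat.card {d : Fˣ // T d (d⁻¹ : Fˣ)} := by
  rw [Nat.card_congr (lowerBlockEquiv Q T), Nat.card_prod, Nat.card_prod, Nat.card_fun,
    Nat.card_eq_fintype_card (α := Fin _), Fintype.card_fin, mul_assoc]

/-- The linear functional `B ↦ tr (M B)` on symmetric matrices. -/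
def traceFunctional {κ : Type*} [Fintype κ] (M : Matrix κ κ F) : symmSubmodule F κ →ₗ[F] F :=
  (Matrix.traceLinearMap κ F F ∘ₗ LinearMap.mulLeft F M) ∘ₗ (symmSubmodule F κ).subtype

theorem traceFunctional_apply {κ : Type*} [Fintype κ] (M : Matrix κ κ F) (B : symmSubmodule F κ) :
    traceFunctional M B = (M * B.1).trace := rfl

/-- Testing on Eᵢᵢ and Eᵢⱼ + Eⱼᵢ gives one direction. Conversely, the terms of tr(MB) at (i,j) and
(j,i) cancel and the diagonal ones vanish. -/
theorem traceFunctional_eq_zero_iff {κ : Type*} [Fintype κ] [DecidableEq κ] (M : Matrix κ κ F) :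
    traceFunctional M = 0 ↔ IsAlternating M := by
  constructor
  · intro h
    refine ⟨fun i => ?_, fun i j => ?_⟩
    · have := LinearMap.congr_fun h ⟨Matrix.single i i 1, transpose_single _ _ _⟩
      rw [traceFunctional_apply] at this
      simpa [trace_mul_single] using this
    · have := LinearMap.congr_fun h ⟨Matrix.single i j 1 + Matrix.single j i 1, by
        show transpose _ = _
        rw [transpose_add, transpose_single, transpose_single, add_comm]⟩
      rw [traceFunctional_apply] at this
      simp only [Matrix.mul_add, trace_add, trace_mul_single, LinearMap.zero_apply,
        MulOpposite.op_one, one_smul] at this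
      linear_combination this
  · intro hM
    ext B
    rw [traceFunctional_apply]
    have h : (M * B.1).trace = ∑ p : κ × κ, M p.1 p.2 * B.1 p.2 p.1 := by
      simp only [trace, diag_apply, mul_apply]
      rw [← Finset.sum_product', Finset.univ_product_univ]
    rw [h]
    refine Finset.sum_involution (fun p _ => (p.2, p.1)) ?_ ?_ ?_ ?_
    · rintro ⟨i, j⟩ _
      simp only
      rw [hM.2 i j, symmSubmodule_apply B i j]
      ring
    · rintro ⟨i, j⟩ _ hne heq
      simp only [Prod.mk.injEq] at heq
      obtain ⟨rfl, -⟩ := heq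
      simp [hM.1] at hne
    · intros; simp
    · intros; simp

/-- The product has zero last row, so being alternating forces its last column to vanish too. -/
theorem isAlternating_diagonal_mul_iff (A : Matrix (Fin (m + 1)) (Fin (m + 1)) F) :
    IsAlternating (diagonal (fun i : Fin (m + 1) => if i.1 < m then 1 else 0) * A) ↔
      (∀ i : Fin m, A i.castSucc (Fin.last m) = 0) ∧
      IsAlternating (A.submatrix Fin.castSucc Fin.castSucc) := by
  simp only [IsAlternating, Fin.forall_fin_succ', diagonal_mul]
  simp [forall_and]
  tauto

end Counting

/-! ### Orders of the groups and the trace count on σP -/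

section GroupOrders

variable {F : Type*} [Field F] {m : ℕ}

theorem card_matrix_det_ne_zero :
    Nat.card {M : Matrix (Fin m) (Fin m) F // True ∧ M.det ≠ 0} = Nat.card (GL (Fin m) F) := by
  refine Nat.card_congr ⟨fun M => GeneralLinearGroup.mkOfDetNeZero M.1 M.2.2,
    fun A => ⟨A.1, trivial, A.det.ne_zero⟩, fun M => rfl, fun A => Units.ext rfl⟩

variable [Finite F]

theorem one_lt_card_field : 1 < Nat.card F := Finite.one_lt_card

theorem card_units_field : Nat.card Fˣ = Nat.card F - 1 := by
  classical
  have := Fintype.ofFinite F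
  rw [Nat.card_eq_fintype_card, Nat.card_eq_fintype_card, Fintype.card_units]

theorem card_GL_succ : Nat.card (GL (Fin (m + 1)) F) =
    (Nat.card F ^ (m + 1) - 1) * Nat.card F ^ m * Nat.card (GL (Fin m) F) := by
  have := Fintype.ofFinite F
  rw [card_GL_field, card_GL_field, Fin.prod_univ_succ, ← Nat.card_eq_fintype_card]
  have h : ∀ i : Fin m, Nat.card F ^ (m + 1) - Nat.card F ^ (i.succ : ℕ) =
      Nat.card F * (Nat.card F ^ m - Nat.card F ^ (i : ℕ)) := by
    intro i
    rw [Nat.mul_sub, Fin.val_succ, pow_succ', pow_succ']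
  simp only [h, Finset.prod_mul_distrib, Finset.prod_const, Finset.card_univ, Fintype.card_fin,
    Fin.val_zero, pow_zero]
  ring

/-- Among the factors qⁱ - 1 of the order of GL, those with odd i < 2k + 1 come from the alternating
matrices; even i and i = 2k + 1 come from `Bconst`. -/
theorem Bconst_mul_altCount (k : ℕ) :
    Bconst (2 * k + 1) (Nat.card F) * (altCount F (Fin (2 * k)) * Nat.card F ^ (2 * k)) =
      Nat.card (GL (Fin (2 * k + 1)) F) := by
  have hB : Bconst (2 * k + 1) (Nat.card F) = Nat.card F ^ (k ^ 2) * (Nat.card F ^ (2 * k + 1) - 1) *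
      ∏ j ∈ Finset.Icc 1 k, (Nat.card F ^ (2 * j) - 1) := by
    have h1 : (2 * k + 1 - 1) ^ 2 / 4 = k ^ 2 := by
      rw [Nat.add_sub_cancel, mul_pow]; omega
    have h2 : (2 * k + 1 - 1) / 2 = k := by omega
    rw [Bconst, h1, h2]
  have hexp : k ^ 2 + k * (k - 1) + 2 * k = 2 * k ^ 2 + k := by
    rcases k with _ | k
    · rfl
    · simp only [Nat.add_sub_cancel]; ring
  have key : Nat.card (GL (Fin (2 * k + 1)) F) = Nat.card F ^ (2 * k ^ 2 + k) *
      (Nat.card F ^ (2 * k + 1) - 1) * (∏ j ∈ Finset.Icc 1 k, (Nat.card F ^ (2 * j) - 1)) *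
      ∏ j ∈ Finset.Icc 1 k, (Nat.card F ^ (2 * j - 1) - 1) := by
    clear hexp hB
    induction k with
    | zero =>
      have := Fintype.ofFinite F
      rw [card_GL_succ, card_GL_field]
      simp
    | succ k ih =>
      have h3 : 2 * (k + 1) + 1 = (2 * k + 1) + 1 + 1 := by ring
      have h4 : 2 * (k + 1) - 1 = 2 * k + 1 := by omega
      rw [h3, card_GL_succ, card_GL_succ, ih, Finset.prod_Icc_succ_top (by omega),
        Finset.prod_Icc_succ_top (by omega), h4]
      have h5 : 2 * (k + 1) ^ 2 + (k + 1) = (2 * k ^ 2 + k) + (2 * k + 1) + (2 * k + 1 + 1) := by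
        ring
      have h6 : 2 * (k + 1) = 2 * k + 1 + 1 := by ring
      rw [h5, h6, pow_add, pow_add]
      ring
  rw [hB, altCount_fin_two_mul, key, ← hexp, pow_add, pow_add]
  ring

theorem choose_two_add_two_mul_self (k : ℕ) : (2 * k + 1).choose 2 = k * (2 * k + 1) := by
  rw [Nat.choose_two_right, Nat.add_sub_cancel]
  have : (2 * k + 1) * (2 * k) = 2 * (k * (2 * k + 1)) := by ring
  rw [this]; omega

/-- Identifies `Aconst` as the index of P ∩ σPσ⁻¹ in P, times the number of symmetric B, times the
number of pairs (alternating block, last row off the corner). -/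
theorem Aconst_eq (k : ℕ) :
    Aconst (2 * k + 1) (Nat.card F) =
      Nat.card F ^ ((2 * k + 1).choose 2) * ((Nat.card F ^ (2 * k + 1) - 1) / (Nat.card F - 1)) *
      Nat.card (symmSubmodule F (Fin (2 * k + 1))) *
      (altCount F (Fin (2 * k)) * Nat.card F ^ (2 * k)) := by
  have h1 : (5 * (2 * k + 1) ^ 2 - 1) / 4 =
      (2 * k + 1).choose 2 + (2 * k + 1 + 1).choose 2 + k * (k - 1) + 2 * k := by
    rw [Nat.choose_succ_succ' (2 * k + 1) 1, Nat.choose_one_right, choose_two_add_two_mul_self]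
    have h : 5 * (2 * k + 1) ^ 2 - 1 = 4 * (5 * k ^ 2 + 5 * k + 1) := by
      have : 5 * (2 * k + 1) ^ 2 = 4 * (5 * k ^ 2 + 5 * k + 1) + 1 := by ring
      omega
    rw [h, Nat.mul_div_cancel_left _ (by norm_num)]
    rcases k with _ | k
    · rfl
    · simp only [Nat.add_sub_cancel]; ring
  have h2 : (2 * k + 1 - 1) / 2 = k := by omega
  rw [Aconst, h1, h2, altCount_fin_two_mul, card_symmSubmodule, pow_add, pow_add, pow_add]
  ring

/-- Equal fibres for a nonzero functional, a single fibre over 0 for the zero one. The additive form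
merges both cases without subtraction, ready to be summed over A. -/
theorem card_symm_trace_eq (A : GL (Fin (m + 1)) F) (c : F)
    (D : Matrix (Fin (m + 1)) (Fin (m + 1)) F) [Decidable (IsAlternating (D * A.1))]
    [Decidable (c = 0)] :
    Nat.card F * Nat.card {B : symmSubmodule F (Fin (m + 1)) // (D * A.1 * B.1).trace = c} +
      (if IsAlternating (D * A.1) then Nat.card (symmSubmodule F (Fin (m + 1))) else 0) =
    Nat.card (symmSubmodule F (Fin (m + 1))) + if IsAlternating (D * A.1) ∧ c = 0 then
      Nat.card F * Nat.card (symmSubmodule F (Fin (m + 1))) else 0 := by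
  by_cases h : IsAlternating (D * A.1)
  · have h0 := (traceFunctional_eq_zero_iff _).2 h
    have h1 : ∀ B : symmSubmodule F (Fin (m + 1)), (D * A.1 * B.1).trace = 0 := fun B => by
      rw [← traceFunctional_apply, h0, LinearMap.zero_apply]
    simp only [h, h1, if_true, true_and]
    by_cases hc : c = 0
    · subst hc
      rw [if_pos rfl, Nat.card_congr (Equiv.subtypeUnivEquiv fun _ => rfl), add_comm]
    · have : IsEmpty {B : symmSubmodule F (Fin (m + 1)) // 0 = c} := ⟨fun B => hc B.2.symm⟩
      simp [hc]
  · have h0 : traceFunctional (D * A.1) ≠ 0 := fun h0 => h ((traceFunctional_eq_zero_iff _).1 h0)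
    simp only [h, if_false, false_and, add_zero]
    rw [mul_comm]
    exact card_fiber_mul_card _ h0 c

variable [CharP F 2]

theorem card_parabolicSubgroup : Nat.card (parabolicSubgroup (m + 1) F) =
    Nat.card (GL (Fin (m + 1)) F) * Nat.card (symmSubmodule F (Fin (m + 1))) := by
  rw [← Nat.card_prod, Nat.card_congr (parabolicEquiv F (m + 1))]

theorem card_parabolic_inter_conj :
    Nat.card {p : parabolicSubgroup (m + 1) F // (sigmaElt (m + 1) m F)⁻¹ * p.1 *
      sigmaElt (m + 1) m F ∈ parabolicSubgroup (m + 1) F} =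
    Nat.card (GL (Fin m) F) * Nat.card F ^ m * (Nat.card F - 1) * Nat.card F ^ (m + 1) := by
  rw [← Nat.card_congr ((parabolicEquiv F (m + 1)).subtypeEquiv fun x =>
    (sigma_conj_mem_iff x).symm), ← card_units_field, ← card_matrix_det_ne_zero,
    ← card_symmSubmodule_last, Nat.card_congr (Equiv.subtypeProdEquivProd
      (p := fun A : GL (Fin (m + 1)) F => ∀ i : Fin m, A.1 i.castSucc (Fin.last m) = 0)
      (q := fun B : symmSubmodule F (Fin (m + 1)) =>
        ∀ i j : Fin m, B.1 i.castSucc j.castSucc = 0)), Nat.card_prod]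
  congr 1
  have h := card_lowerBlock (F := F) (m := m) (fun _ => True) (fun _ _ => True)
  simp only [true_and, and_true] at h ⊢
  rw [h]
  congr 1
  exact Nat.card_congr (Equiv.subtypeUnivEquiv fun _ => trivial)

theorem card_parabolicSubgroup_eq_index_mul :
    Nat.card (parabolicSubgroup (m + 1) F) =
    Nat.card F ^ ((m + 1).choose 2) * ((Nat.card F ^ (m + 1) - 1) / (Nat.card F - 1)) *
    Nat.card {p : parabolicSubgroup (m + 1) F // (sigmaElt (m + 1) m F)⁻¹ * p.1 *
      sigmaElt (m + 1) m F ∈ parabolicSubgroup (m + 1) F} := by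
  have hd : (Nat.card F ^ (m + 1) - 1) / (Nat.card F - 1) * (Nat.card F - 1) =
      Nat.card F ^ (m + 1) - 1 := by
    refine Nat.div_mul_cancel ?_
    simpa using Nat.sub_dvd_pow_sub_pow (Nat.card F) 1 (m + 1)
  rw [card_parabolic_inter_conj, card_parabolicSubgroup, card_GL_succ, card_symmSubmodule,
    Nat.choose_succ_succ' (m + 1) 1, Nat.choose_one_right, pow_add _ (m + 1)]
  generalize (Nat.card F ^ (m + 1) - 1) / (Nat.card F - 1) = I at hd ⊢
  rw [← hd]
  ring

theorem card_trace_sigma_mul (β : F) :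
    Nat.card F * Nat.card {p : parabolicSubgroup (m + 1) F //
      (sigmaElt (m + 1) m F * p.1).1.trace = β} +
      Nat.card (symmSubmodule F (Fin (m + 1))) *
        (altCount F (Fin m) * Nat.card F ^ m * (Nat.card F - 1)) =
    Nat.card (symmSubmodule F (Fin (m + 1))) * Nat.card (GL (Fin (m + 1)) F) +
      Nat.card F * Nat.card (symmSubmodule F (Fin (m + 1))) *
        (altCount F (Fin m) * Nat.card F ^ m * unitTraceCount F β) := by
  classical
  have := Fintype.ofFinite (GL (Fin (m + 1)) F)
  set D : Matrix (Fin (m + 1)) (Fin (m + 1)) F := diagonal fun i => if i.1 < m then 1 else 0 with hD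
  -- The value required of tr(DAB) is -c A; the sign is immaterial in characteristic two.
  let c : GL (Fin (m + 1)) F → F := fun A =>
    1 + A.1 (Fin.last m) (Fin.last m) + (A⁻¹).1 (Fin.last m) (Fin.last m) - β
  have hcard : Nat.card {p : parabolicSubgroup (m + 1) F //
      (sigmaElt (m + 1) m F * p.1).1.trace = β} = ∑ A : GL (Fin (m + 1)) F,
      Nat.card {B : symmSubmodule F (Fin (m + 1)) // (D * A.1 * B.1).trace = c A} := by
    rw [← Nat.card_sigma]
    refine Nat.card_congr (((parabolicEquiv F (m + 1)).subtypeEquiv fun x => ?_).symm.trans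
      (Equiv.subtypeProdEquivSigmaSubtype fun A (B : symmSubmodule F (Fin (m + 1))) =>
        (D * A.1 * B.1).trace = c A))
    rw [trace_sigma_mul_parabolicEquiv, ← hD]
    have h2 : (2 : F) = 0 := CharTwo.two_eq_zero
    simp only [c]
    generalize (D * x.1.1 * x.2.1).trace = t
    constructor
    · intro h
      linear_combination h + (1 + x.1.1 (Fin.last m) (Fin.last m) +
        (x.1⁻¹).1 (Fin.last m) (Fin.last m) - β) * h2
    · intro h
      linear_combination h - (1 + x.1.1 (Fin.last m) (Fin.last m) +
        (x.1⁻¹).1 (Fin.last m) (Fin.last m) - β) * h2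
  have halt : ∀ T : F → F → Prop, Nat.card {A : GL (Fin (m + 1)) F // IsAlternating (D * A.1) ∧
      T (A.1 (Fin.last m) (Fin.last m)) ((A⁻¹).1 (Fin.last m) (Fin.last m))} =
      altCount F (Fin m) * Nat.card F ^ m * Nat.card {d : Fˣ // T d (d⁻¹ : Fˣ)} := by
    intro T
    rw [altCount, ← card_lowerBlock]
    refine Nat.card_congr (Equiv.subtypeEquivRight fun A => ?_)
    rw [hD, isAlternating_diagonal_mul_iff, and_assoc]
  have h1 := halt fun _ _ => True
  have h2 := halt fun d e => 1 + d + e - β = 0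
  have h3 : Nat.card {d : Fˣ // (1 : F) + d + (d⁻¹ : Fˣ) - β = 0} = unitTraceCount F β := by
    simp only [unitTraceCount, sub_eq_zero]
  have h4 : Nat.card {d : Fˣ // True} = Nat.card F - 1 := by
    rw [← card_units_field]
    exact Nat.card_congr (Equiv.subtypeUnivEquiv fun _ => trivial)
  rw [h3] at h2
  rw [h4] at h1
  simp only [and_true] at h1
  have hsum := Finset.sum_congr (rfl : (Finset.univ : Finset (GL (Fin (m + 1)) F)) = _)
    fun A _ => card_symm_trace_eq A (c A) D
  rw [Finset.sum_add_distrib, Finset.sum_add_distrib, ← Finset.mul_sum, ← hcard,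
    ← Finset.sum_filter, ← Finset.sum_filter, Finset.sum_const, Finset.sum_const, Finset.sum_const,
    ← Fintype.card_subtype, ← Fintype.card_subtype, ← Nat.card_eq_fintype_card,
    ← Nat.card_eq_fintype_card, Finset.card_univ, ← Nat.card_eq_fintype_card, h1] at hsum
  have h2' : Nat.card {A : GL (Fin (m + 1)) F // IsAlternating (D * A.1) ∧ c A = 0} = _ := h2
  rw [h2'] at hsum
  simp only [smul_eq_mul] at hsum
  linarith

end GroupOrders

/-! ### Fibre sizes of the trace on DC -/

section DoubleCosets

variable {F : Type*} [Field F] [Finite F] [CharP F 2] (k : ℕ)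

/-- Reduction of counts over `DC` to counts over the parabolic subgroup. -/
theorem card_DC_filter {m : ℕ} (T : GL (OIdx (m + 1)) F → Prop) (hT : ∀ x y, T (x * y) ↔ T (y * x)) :
    Nat.card {w : DC (m + 1) F // T w.1} =
      Nat.card F ^ ((m + 1).choose 2) * ((Nat.card F ^ (m + 1) - 1) / (Nat.card F - 1)) *
      Nat.card {p : parabolicSubgroup (m + 1) F // T (sigmaElt (m + 1) m F * p.1)} := by
  have h := card_doubleCoset_mul_card_stabilizer (parabolicSubgroup (m + 1) F)
    (sigmaElt (m + 1) m F) T hT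
  have h1 : Nat.card {w : DC (m + 1) F // T w.1} = Nat.card {w // w ∈ DoubleCoset.doubleCoset
      (sigmaElt (m + 1) m F) (parabolicSubgroup (m + 1) F : Set (GL (OIdx (m + 1)) F))
      (parabolicSubgroup (m + 1) F) ∧ T w} :=
    Nat.card_congr (Equiv.subtypeSubtypeEquivSubtypeInter (fun w => w ∈ DC (m + 1) F) T)
  rw [← h1] at h
  have hpos : 0 < Nat.card {p : parabolicSubgroup (m + 1) F // (sigmaElt (m + 1) m F)⁻¹ * p.1 *
      sigmaElt (m + 1) m F ∈ parabolicSubgroup (m + 1) F} := by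
    have : Nonempty {p : parabolicSubgroup (m + 1) F // (sigmaElt (m + 1) m F)⁻¹ * p.1 *
      sigmaElt (m + 1) m F ∈ parabolicSubgroup (m + 1) F} := ⟨⟨1, by simp⟩⟩
    exact Nat.card_pos
  rw [card_parabolicSubgroup_eq_index_mul] at h
  refine Nat.eq_of_mul_eq_mul_right hpos (h.trans ?_)
  ring

theorem card_DC : Nat.card (DC (2 * k + 1) F) =
    Aconst (2 * k + 1) (Nat.card F) * Bconst (2 * k + 1) (Nat.card F) := by
  have h := card_DC_filter (F := F) (m := 2 * k) (fun _ => True) (fun _ _ => Iff.rfl)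
  rw [Nat.card_congr (Equiv.subtypeUnivEquiv fun _ => trivial),
    Nat.card_congr (Equiv.subtypeUnivEquiv fun _ => trivial), card_parabolicSubgroup,
    ← Bconst_mul_altCount] at h
  rw [h, Aconst_eq]
  ring

/-- This is `card_trace_sigma_mul` multiplied by the index, with the group orders rewritten through
`Aconst` and `Bconst`. -/
theorem card_DC_trace (β : F) :
    Nat.card F * Nat.card {w : DC (2 * k + 1) F // w.1.1.trace = β} +
      Aconst (2 * k + 1) (Nat.card F) * (Nat.card F - 1) =
    Aconst (2 * k + 1) (Nat.card F) * (Bconst (2 * k + 1) (Nat.card F) +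
      Nat.card F * unitTraceCount F β) := by
  rw [card_DC_filter (F := F) (m := 2 * k) (fun w => w.1.trace = β)
    (fun x y => by rw [Units.val_mul, Units.val_mul, trace_mul_comm])]
  have h := card_trace_sigma_mul (m := 2 * k) β
  rw [← Bconst_mul_altCount] at h
  rw [Aconst_eq]
  generalize Nat.card F ^ ((2 * k + 1).choose 2) *
    ((Nat.card F ^ (2 * k + 1) - 1) / (Nat.card F - 1)) = I
  have h' := congrArg (I * ·) h
  linarith

end DoubleCosets

/-! ### The weight distribution -/

theorem mainTheorem3 {F : Type*} [Field F] [Fintype F] [DecidableEq F] [Algebra (ZMod 2) F]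
    (r q : ℕ) (hq : q = 2 ^ r) (hF : Fintype.card F = q) (n : ℕ) (hn : Odd n)
    (N : ℕ) (hN : N = Nat.card (DC n F)) (g : Fin N ≃ DC n F) :
    N = Aconst n q * Bconst n q ∧
    ∀ j : ℕ, j ≤ N →
      weightCount (codeDC g) j =
        ∑ ν ∈ (Finset.piAntidiag (Finset.univ : Finset F) j).filter
            (fun ν => ∑ β : F, ν β • β = 0),
          (Aconst n q * (Bconst n q + 1) / q).choose (ν 1) *
          (∏ β : F with β ≠ 1 ∧ absTr r ((β - 1)⁻¹) = 0,
            (Aconst n q * (Bconst n q + q + 1) / q).choose (ν β)) *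
          (∏ β : F with β ≠ 1 ∧ absTr r ((β - 1)⁻¹) = 1,
            (Aconst n q * (Bconst n q + 1 - q) / q).choose (ν β)) := by
  have : CharP F 2 := charP_of_injective_algebraMap (algebraMap (ZMod 2) F).injective 2
  have hF2 : Fintype.card F = 2 ^ r := hF.trans hq
  obtain rfl : q = Nat.card F := by rw [Nat.card_eq_fintype_card, hF]
  have hq2 : 2 ≤ Nat.card F := one_lt_card_field
  have hle := le_Bconst_add_one hn hq2
  obtain ⟨k, rfl⟩ := hn
  refine ⟨hN.trans (card_DC k), fun j _ => ?_⟩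
  rw [weightCount_codeDC]
  have htr := card_DC_trace (F := F) k
  generalize Aconst (2 * k + 1) (Nat.card F) = A at htr
  generalize Bconst (2 * k + 1) (Nat.card F) = B at htr hle
  -- With q = s + 1 and B = s + t the truncated difference B + 1 - q is exactly t; `hle` guarantees
  -- s ≤ B.
  obtain ⟨s, hs⟩ : ∃ s, Nat.card F = s + 1 := ⟨Nat.card F - 1, by omega⟩
  obtain ⟨t, ht⟩ : ∃ t, B = s + t := ⟨B - s, by omega⟩
  rw [hs] at htr ⊢
  simp only [Nat.add_sub_cancel] at htr
  have hf1 : A * (B + 1) / (s + 1) = Nat.card {w : DC (2 * k + 1) F // w.1.1.trace = 1} := by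
    have := htr 1
    rw [unitTraceCount_one] at this
    refine Nat.div_eq_of_eq_mul_right (by omega) ?_
    linarith
  have hf2 : ∀ β : F, β ≠ 1 → absTr r ((β - 1)⁻¹) = 0 → A * (B + (s + 1) + 1) / (s + 1) =
      Nat.card {w : DC (2 * k + 1) F // w.1.1.trace = β} := by
    intro β h1 h2
    have := htr β
    rw [unitTraceCount_of_absTr_eq_zero hF2 h1 h2] at this
    refine Nat.div_eq_of_eq_mul_right (by omega) ?_
    linarith
  have hf0 : ∀ β : F, β ≠ 1 → absTr r ((β - 1)⁻¹) = 1 → A * (B + 1 - (s + 1)) / (s + 1) =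
      Nat.card {w : DC (2 * k + 1) F // w.1.1.trace = β} := by
    intro β h1 h2
    have := htr β
    rw [unitTraceCount_of_absTr_eq_one hF2 h1 h2] at this
    have e : B + 1 - (s + 1) = t := by omega
    refine Nat.div_eq_of_eq_mul_right (by omega) ?_
    rw [e]
    rw [ht] at this
    linarith
  refine Finset.sum_congr rfl fun ν _ => ?_
  rw [hf1, ← Finset.mul_prod_erase Finset.univ _ (Finset.mem_univ (1 : F)), mul_assoc]
  congr 1
  have herase : (Finset.univ : Finset F).erase 1 = Finset.univ.filter (· ≠ 1) := by
    ext β; simp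
  rw [herase, ← Finset.prod_filter_mul_prod_filter_not (Finset.univ.filter (· ≠ (1 : F)))
    (fun β => absTr r ((β - 1)⁻¹) = 0), Finset.filter_filter, Finset.filter_filter]
  -- The trace takes only the values 0 and 1, so the two products exhaust all β ≠ 1.
  have hnot : (Finset.univ.filter fun β : F => β ≠ 1 ∧ ¬absTr r ((β - 1)⁻¹) = 0) =
      Finset.univ.filter fun β : F => β ≠ 1 ∧ absTr r ((β - 1)⁻¹) = 1 := by
    refine Finset.filter_congr fun β _ => and_congr_right fun _ => ⟨fun h => ?_, fun h => ?_⟩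
    · exact (absTr_eq_zero_or_one hF2 _).resolve_left h
    · rw [h]; exact one_ne_zero
  rw [hnot]
  congr 1
  · refine Finset.prod_congr rfl fun β hβ => ?_
    rw [hf2 β (Finset.mem_filter.1 hβ).2.1 (Finset.mem_filter.1 hβ).2.2]
  · refine Finset.prod_congr rfl fun β hβ => ?_
    rw [hf0 β (Finset.mem_filter.1 hβ).2.1 (Finset.mem_filter.1 hβ).2.2]
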